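/- Let $\mathbb S^3=\{x\in\mathbb R^4:|x|=1\}$ carry the round metric, with Levi-Civita gradient $\nabla$, volume measure $dM$ and coordinate functions $\phi_1,\dots,\phi_4$ (the restrictions of $x_1,\dots,x_4$). Regard $\mathbb S^3\subset\mathbb R^4\times\{0\}\subset\mathbb R^6=\mathbb C^3$ and let $\varpi=dx^1\wedge dx^2+dx^3\wedge dx^4+dx^5\wedge dx^6$ be the Kähler form, evaluated on vectors tangent to $\mathbb S^3$. Write $\|\nabla f\|_{L^2}^2=\int_{\mathbb S^3}|\nabla f|^2\,dM$ and let $E_{\lambda_1}$, $\lambda_1=3$, be the space of smooth functions $u$ on $\mathbb S^3$ with $-\Delta u=3u$, that is, $\int\langle\nabla u,\nabla g\rangle\,dM=3\int ug\,dM$ for all smooth $g$. Then for all smooth $f,h:\mathbb S^3\to\mathbb R$: 1. $$-\int_{\mathbb S^3}\varpi(\nabla f,\nabla h)\,dM\le\frac23\,\|\nabla f\|_{L^2}\,\|\nabla h\|_{L^2}.$$ 2. Equality holds if and only if $f$ is constant, or $h$ is constant, or there are real constants $a,b,c$ with $c>0$ and functions $f_1,h_1\in E_{\lambda_1}$ with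 $f=a+f_1$, $h=b+c\,h_1$ such that $f_1=\sum_i\mu_i\phi_i$ and $h_1=\sum_i\sigma_i\phi_i$ for real coefficients satisfying $\sigma_2=-\mu_1$, $\sigma_1=\mu_2$, $\sigma_4=-\mu_3$, $\sigma_3=\mu_4$. 3. In particular, if $\int f\,dM=\int h\,dM=0$ and $\|\nabla f\|_{L^2}=\|\nabla h\|_{L^2}$, then equality holds if and only if $f,h\in E_{\lambda_1}$ with $f=\sum_i\mu_i\phi_i$ and $h=\sum_i\sigma_i\phi_i$, where $\sigma_2=-\mu_1$, $\sigma_1=\mu_2$, $\sigma_4=-\mu_3$, $\sigma_3=\mu_4$. -/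

import Mathlib

open scoped Manifold ContDiff

/-- The unit sphere of `ℝ⁴ = ℂ²`, with Mathlib's smooth structure. -/
abbrev S3 : Type := Metric.sphere (0 : EuclideanSpace ℝ (Fin 4)) 1

/-- Smooth real functions on the sphere. -/
def SmoothS3 (f : S3 → ℝ) : Prop := ContMDiff (𝓡 3) 𝓘(ℝ, ℝ) ∞ f

/-- The differential `T_x S³ → ℝ⁴` of the inclusion of the sphere in `ℝ⁴`. -/
noncomputable def inclDeriv (x : S3) :
    TangentSpace (𝓡 3) x →L[ℝ] EuclideanSpace ℝ (Fin 4) :=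
  mvfderiv (𝓡 3) ((↑) : S3 → EuclideanSpace ℝ (Fin 4)) x

/-- The differential `df_x : T_x S³ → ℝ`. -/
noncomputable def diffS3 (f : S3 → ℝ) (x : S3) : TangentSpace (𝓡 3) x →L[ℝ] ℝ :=
  mvfderiv (𝓡 3) f x

/-- `v ∈ ℝ⁴` is (the image in `ℝ⁴` of) the gradient of `f` at `x` for the round metric, the metric
induced from `ℝ⁴`: it is tangent to the sphere at `x`, and its inner product with each tangent
vector `w` is `df_x w`. -/
def IsGradS3 (f : S3 → ℝ) (x : S3) (v : EuclideanSpace ℝ (Fin 4)) : Prop :=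
  inner ℝ v (x : EuclideanSpace ℝ (Fin 4)) = 0 ∧
    ∀ w : TangentSpace (𝓡 3) x, inner ℝ v (inclDeriv x w) = diffS3 f x w

theorem inclDeriv_injective (x : S3) : Function.Injective (inclDeriv x) := by
  have : Fact (Module.finrank ℝ (EuclideanSpace ℝ (Fin 4)) = 3 + 1) := ⟨by simp⟩
  exact injective_mvfderiv_subtypeVal_sphere (n := 3) x

theorem range_inclDeriv (x : S3) :
    (inclDeriv x).range = (Submodule.span ℝ {(x : EuclideanSpace ℝ (Fin 4))})ᗮ := by
  have : Fact (Module.finrank ℝ (EuclideanSpace ℝ (Fin 4)) = 3 + 1) := ⟨by simp⟩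
  exact range_mvfderiv_subtypeVal (n := 3) x

theorem existsUnique_isGradS3 (f : S3 → ℝ) (x : S3) : ∃! v, IsGradS3 f x v := by
  obtain ⟨l, hl⟩ := LinearMap.exists_leftInverse_of_injective
    (inclDeriv x).toLinearMap (LinearMap.ker_eq_bot.2 (inclDeriv_injective x))
  have hl' : ∀ w, l (inclDeriv x w) = w := fun w => LinearMap.congr_fun hl w
  let L : EuclideanSpace ℝ (Fin 4) →ₗ[ℝ] ℝ := (diffS3 f x).toLinearMap ∘ₗ l
  let u := (InnerProductSpace.toDual ℝ (EuclideanSpace ℝ (Fin 4))).symm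
    (LinearMap.toContinuousLinearMap L)
  have hu : ∀ w, inner ℝ u w = L w := fun w => by
    simp [u]
  let K := Submodule.span ℝ {(x : EuclideanSpace ℝ (Fin 4))}
  refine ⟨Kᗮ.starProjection u, ⟨?_, ?_⟩, ?_⟩
  · exact (Submodule.mem_orthogonal_singleton_iff_inner_left).1
      (Submodule.starProjection_apply_mem Kᗮ u)
  · intro w
    have hw : inclDeriv x w ∈ Kᗮ := by
      rw [← range_inclDeriv]; exact ⟨w, rfl⟩
    rw [Submodule.inner_starProjection_left_eq_right,
      Submodule.starProjection_eq_self_iff.2 hw, hu]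
    simp [L, hl']
  · intro v hv
    have hd : v - Kᗮ.starProjection u ∈ (inclDeriv x).range := by
      rw [range_inclDeriv]
      refine Submodule.sub_mem _ ?_ (Submodule.starProjection_apply_mem Kᗮ u)
      exact (Submodule.mem_orthogonal_singleton_iff_inner_left).2 hv.1
    obtain ⟨w, hw⟩ := hd
    have hw' : inclDeriv x w = v - Kᗮ.starProjection u := hw
    have hmw : inclDeriv x w ∈ Kᗮ := by
      rw [← range_inclDeriv]; exact ⟨w, rfl⟩
    have h0 : inner ℝ (v - Kᗮ.starProjection u) (inclDeriv x w) = (0 : ℝ) := by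
      rw [inner_sub_left, hv.2 w, Submodule.inner_starProjection_left_eq_right,
        Submodule.starProjection_eq_self_iff.2 hmw, hu]
      simp [L, hl']
    rw [hw', inner_self_eq_zero] at h0
    exact sub_eq_zero.1 h0

/-- The gradient of `f` at `x` for the round metric, as a vector of `ℝ⁴` tangent to the sphere. -/
noncomputable def gradS3 (f : S3 → ℝ) (x : S3) : EuclideanSpace ℝ (Fin 4) :=
  (existsUnique_isGradS3 f x).choose

theorem isGradS3_gradS3 (f : S3 → ℝ) (x : S3) : IsGradS3 f x (gradS3 f x) :=
  (existsUnique_isGradS3 f x).choose_spec.1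

/-- The Riemannian volume measure `dM` of the unit sphere. -/
noncomputable def volS3 : MeasureTheory.Measure S3 :=
  (MeasureTheory.volume : MeasureTheory.Measure (EuclideanSpace ℝ (Fin 4))).toSphere

/-- The `L²` norm of the gradient of `f`. -/
noncomputable def gradNorm (f : S3 → ℝ) : ℝ := Real.sqrt (∫ x, ‖gradS3 f x‖ ^ 2 ∂volS3)

/-- The Kähler form `dx¹² + dx³⁴ + dx⁵⁶` of `ℂ³ = ℝ⁶`. -/
def kahlerForm (v w : EuclideanSpace ℝ (Fin 6)) : ℝ :=
  (v 0 * w 1 - v 1 * w 0) + (v 2 * w 3 - v 3 * w 2) + (v 4 * w 5 - v 5 * w 4)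

/-- The inclusion `ℝ⁴ = ℝ⁴ × {0} ⊆ ℝ⁶` (a linear map, hence its own differential). -/
def inclC3 (v : EuclideanSpace ℝ (Fin 4)) : EuclideanSpace ℝ (Fin 6) :=
  !₂[v 0, v 1, v 2, v 3, 0, 0]

/-- `∫_{S³} ϖ(∇f, ∇h) dM`, with the Kähler form pulled back to the sphere. -/
noncomputable def kahlerIntegral (f h : S3 → ℝ) : ℝ :=
  ∫ x, kahlerForm (inclC3 (gradS3 f x)) (inclC3 (gradS3 h x)) ∂volS3

/-- The coordinate functions `φ_i` of the inclusion of the sphere, `i = 0, …, 3`. -/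
def coordS3 (i : Fin 4) (x : S3) : ℝ := (x : EuclideanSpace ℝ (Fin 4)) i

/-- The smooth functions `f` with `-Δ f = lam • f` on `S³`, in Green's form
`∫ ⟨∇f, ∇g⟩ dM = lam ∫ f g dM` for all smooth `g`. -/
def eigenspaceS3 (lam : ℝ) : Set (S3 → ℝ) :=
  {f | SmoothS3 f ∧ ∀ g : S3 → ℝ, SmoothS3 g →
    ∫ x, inner ℝ (gradS3 f x) (gradS3 g x) ∂volS3 = lam * ∫ x, f x * g x ∂volS3}

/-- The relation between the coefficients `μ` of `f` and `σ` of `h`. With indices `1, …, 4`: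
`σ₂ = -μ₁`, `σ₁ = μ₂`, `σ₄ = -μ₃`, `σ₃ = μ₄`. -/
def IsRotated (μ σ : Fin 4 → ℝ) : Prop :=
  σ 1 = -μ 0 ∧ σ 0 = μ 1 ∧ σ 3 = -μ 2 ∧ σ 2 = μ 3

/-! View `ℝ⁴` as the quaternions. The fields `y ↦ iy, jy, ky` are orthonormal Killing fields on the
sphere; write I, J, K for the corresponding derivatives. The orbits of I are the Hopf circles and J,
K span the contact planes. In this frame `|∇f|² = (If)² + (Jf)² + (Kf)²` and `ϖ(∇f,∇h) = Jf Kh - Kf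
Jh`. Integrating by parts and using `KJ - JK = 2I` gives `∫ ϖ(∇f,∇h) = 2 ∫ f Ih = ∫ (f Ih - h If)`.

Split the three copies of the integral in `‖∇f‖² + ‖∇h‖² + 3 ∫ϖ` as two plus one (`deficit_eq`). The
two copies complete the squares `(Jf + Kh)² + (Kf - Jh)²`, the Cauchy-Riemann defect of `u = f - ih`
on the contact planes. The third copy joins `(If)² + (Ih)²`; on each Hopf circle the result is the
quadratic form of `T(T - 1)` on `u`, where `T = -i d/dt`, with Fourier symbol `n² - n ≥ 0` for
integers `n`. So the deficit is nonnegative. Rescaling `h` until both gradient norms agree turns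
this additive bound into the product bound (`neg_kahlerIntegral_le`).

If the deficit vanishes, `u` has only the frequencies 0 and 1 on Hopf circles and is Cauchy-Riemann
on the contact planes. Since half a turn is the antipodal map, these frequencies are the even and
odd parts of `u`. The even part, extended with degree zero, and the odd part, extended with degree
one, are holomorphic on `ℂ² \ {0}`; Liouville's theorem on a complex line makes the first constant
and the second linear (`IsContactHolomorphic.eq_affine`). Hence `f - ih = c + αz + βw` on the
sphere, and the real and imaginary parts give the stated coefficients (`deficit_eq_zero_iff`). -/

open MeasureTheory Filter Topology

/-! ### The quaternionic frame of `ℝ⁴` -/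

/-- The ambient Euclidean space `ℝ⁴`. -/
abbrev R4 : Type := EuclideanSpace ℝ (Fin 4)

instance fact_finrank_R4 : Fact (Module.finrank ℝ R4 = 3 + 1) := ⟨by simp⟩

/-- Left multiplication by the quaternion `i`; this is the complex structure of `ℝ⁴ = ℂ²`. -/
noncomputable def quatI : R4 →L[ℝ] R4 := LinearMap.toContinuousLinearMap
  { toFun := fun y => !₂[-y 1, y 0, -y 3, y 2]
    map_add' := fun x y => by ext i; fin_cases i <;> simp <;> ring
    map_smul' := fun c y => by ext i; fin_cases i <;> simp }

/-- Left multiplication by the quaternion `j`. -/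
noncomputable def quatJ : R4 →L[ℝ] R4 := LinearMap.toContinuousLinearMap
  { toFun := fun y => !₂[-y 2, y 3, y 0, -y 1]
    map_add' := fun x y => by ext i; fin_cases i <;> simp <;> ring
    map_smul' := fun c y => by ext i; fin_cases i <;> simp }

/-- Left multiplication by the quaternion `k`. -/
noncomputable def quatK : R4 →L[ℝ] R4 := LinearMap.toContinuousLinearMap
  { toFun := fun y => !₂[-y 3, -y 2, y 1, y 0]
    map_add' := fun x y => by ext i; fin_cases i <;> simp <;> ring
    map_smul' := fun c y => by ext i; fin_cases i <;> simp }

theorem quatI_apply (y : R4) : quatI y = !₂[-y 1, y 0, -y 3, y 2] := rfl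
theorem quatJ_apply (y : R4) : quatJ y = !₂[-y 2, y 3, y 0, -y 1] := rfl
theorem quatK_apply (y : R4) : quatK y = !₂[-y 3, -y 2, y 1, y 0] := rfl

theorem inner_R4 (v w : R4) :
    inner ℝ v w = v 0 * w 0 + v 1 * w 1 + v 2 * w 2 + v 3 * w 3 := by
  simp [PiLp.inner_apply, Fin.sum_univ_four, mul_comm]

theorem norm_sq_R4 (v : R4) : ‖v‖ ^ 2 = v 0 ^ 2 + v 1 ^ 2 + v 2 ^ 2 + v 3 ^ 2 := by
  rw [← real_inner_self_eq_norm_sq, inner_R4]; ring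

theorem quatI_quatI (y : R4) : quatI (quatI y) = -y := by
  ext i; fin_cases i <;> simp [quatI_apply]
theorem quatJ_quatJ (y : R4) : quatJ (quatJ y) = -y := by
  ext i; fin_cases i <;> simp [quatJ_apply]
theorem quatK_quatK (y : R4) : quatK (quatK y) = -y := by
  ext i; fin_cases i <;> simp [quatK_apply]
theorem quatI_quatJ (y : R4) : quatI (quatJ y) = quatK y := by
  ext i; fin_cases i <;> simp [quatI_apply, quatJ_apply, quatK_apply]
theorem quatI_quatK (y : R4) : quatI (quatK y) = -quatJ y := by
  ext i; fin_cases i <;> simp [quatI_apply, quatJ_apply, quatK_apply]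
theorem quatK_quatJ (y : R4) : quatK (quatJ y) = -quatI y := by
  ext i; fin_cases i <;> simp [quatI_apply, quatJ_apply, quatK_apply]
theorem quatJ_quatK (y : R4) : quatJ (quatK y) = quatI y := by
  ext i; fin_cases i <;> simp [quatI_apply, quatJ_apply, quatK_apply]

theorem norm_quatI (y : R4) : ‖quatI y‖ = ‖y‖ := by
  rw [← sq_eq_sq₀ (norm_nonneg _) (norm_nonneg _), norm_sq_R4, norm_sq_R4]
  simp [quatI_apply]; ring
theorem norm_quatJ (y : R4) : ‖quatJ y‖ = ‖y‖ := by
  rw [← sq_eq_sq₀ (norm_nonneg _) (norm_nonneg _), norm_sq_R4, norm_sq_R4]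
  simp [quatJ_apply]; ring
theorem norm_quatK (y : R4) : ‖quatK y‖ = ‖y‖ := by
  rw [← sq_eq_sq₀ (norm_nonneg _) (norm_nonneg _), norm_sq_R4, norm_sq_R4]
  simp [quatK_apply]; ring

theorem inner_quatI_self (y : R4) : inner ℝ y (quatI y) = 0 := by
  rw [inner_R4]; simp [quatI_apply]; ring
theorem inner_quatJ_self (y : R4) : inner ℝ y (quatJ y) = 0 := by
  rw [inner_R4]; simp [quatJ_apply]; ring
theorem inner_quatK_self (y : R4) : inner ℝ y (quatK y) = 0 := by
  rw [inner_R4]; simp [quatK_apply]; ring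

/-- Parseval's identity in the frame `x, ix, jx, kx`. -/
theorem norm_sq_mul_inner (x v w : R4) :
    ‖x‖ ^ 2 * inner ℝ v w = inner ℝ v x * inner ℝ w x +
      inner ℝ v (quatI x) * inner ℝ w (quatI x) + inner ℝ v (quatJ x) * inner ℝ w (quatJ x) +
      inner ℝ v (quatK x) * inner ℝ w (quatK x) := by
  rw [norm_sq_R4]
  simp only [inner_R4]
  simp [quatI_apply, quatJ_apply, quatK_apply]
  ring

/-- The Kähler form in the frame `x, ix, jx, kx`. -/
theorem norm_sq_mul_kahlerForm (x v w : R4) :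
    ‖x‖ ^ 2 * kahlerForm (inclC3 v) (inclC3 w) =
      inner ℝ v x * inner ℝ w (quatI x) - inner ℝ v (quatI x) * inner ℝ w x +
      (inner ℝ v (quatJ x) * inner ℝ w (quatK x) - inner ℝ v (quatK x) * inner ℝ w (quatJ x)) := by
  rw [norm_sq_R4]
  simp only [inner_R4]
  simp [quatI_apply, quatJ_apply, quatK_apply, kahlerForm, inclC3]
  ring

/-- Expansion of a vector in the frame `x, ix, jx, kx`. -/
theorem frame_expansion (x v : R4) :
    ‖x‖ ^ 2 • v = inner ℝ v x • x + inner ℝ v (quatI x) • quatI x +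
      inner ℝ v (quatJ x) • quatJ x + inner ℝ v (quatK x) • quatK x := by
  rw [norm_sq_R4]
  simp only [inner_R4]
  ext i
  fin_cases i <;> simp [quatI_apply, quatJ_apply, quatK_apply] <;> ring

theorem kahlerForm_smul_right (v w : R4) (c : ℝ) :
    kahlerForm (inclC3 v) (inclC3 (c • w)) = c * kahlerForm (inclC3 v) (inclC3 w) := by
  simp [kahlerForm, inclC3]; ring

/-! ### Radial extension and the gradient on the sphere -/

theorem norm_S3 (x : S3) : ‖(x : R4)‖ = 1 := norm_eq_of_mem_sphere x

theorem S3_ne_zero (x : S3) : (x : R4) ≠ 0 := ne_zero_of_mem_unit_sphere x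

open Classical in
/-- The radial projection of `ℝ⁴ \ {0}` onto the sphere. -/
noncomputable def radialProj (y : R4) : S3 :=
  if h : y = 0 then ⟨EuclideanSpace.single 0 1, by simp⟩
  else ⟨‖y‖⁻¹ • y, by simp [norm_smul, h]⟩

theorem coe_radialProj {y : R4} (h : y ≠ 0) : (radialProj y : R4) = ‖y‖⁻¹ • y := by
  simp [radialProj, h]

theorem radialProj_coe (x : S3) : radialProj (x : R4) = x := by
  apply Subtype.ext
  rw [coe_radialProj (S3_ne_zero x), norm_S3, inv_one, one_smul]

theorem radialProj_smul {c : ℝ} (hc : 0 < c) (y : R4) : radialProj (c • y) = radialProj y := by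
  by_cases h : y = 0
  · simp [h]
  · apply Subtype.ext
    rw [coe_radialProj h, coe_radialProj (smul_ne_zero hc.ne' h), norm_smul,
      Real.norm_of_nonneg hc.le, smul_smul]
    congr 1
    have : ‖y‖ ≠ 0 := norm_ne_zero_iff.2 h
    field_simp

/-- The extension of a function on the sphere which is constant on rays. -/
noncomputable def radialExt (f : S3 → ℝ) (y : R4) : ℝ := f (radialProj y)

theorem radialExt_coe (f : S3 → ℝ) (x : S3) : radialExt f (x : R4) = f x := by
  rw [radialExt, radialProj_coe]

theorem radialExt_smul (f : S3 → ℝ) {c : ℝ} (hc : 0 < c) (y : R4) :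
    radialExt f (c • y) = radialExt f y := by
  rw [radialExt, radialProj_smul hc, radialExt]

/-- `ℝ⁴ \ {0}`. -/
def puncturedR4 : TopologicalSpace.Opens R4 := ⟨{0}ᶜ, isOpen_compl_singleton⟩

theorem contMDiff_radialProj_subtype :
    ContMDiff (𝓡 4) (𝓡 3) ∞ (fun y : puncturedR4 => radialProj (y : R4)) := by
  have h : ContMDiff 𝓘(ℝ, R4) 𝓘(ℝ, R4) ∞
      (fun y : puncturedR4 => ‖(y : R4)‖⁻¹ • (y : R4)) := by
    intro y
    have hy : (y : R4) ≠ 0 := y.2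
    refine (contMDiffAt_subtype_iff (f := fun y : R4 => ‖y‖⁻¹ • y)).2 ?_
    apply ContDiffAt.contMDiffAt
    exact ((contDiffAt_norm ℝ hy).inv (norm_ne_zero_iff.2 hy)).smul contDiffAt_id
  have hm : ∀ y : puncturedR4, ‖(y : R4)‖⁻¹ • (y : R4) ∈ Metric.sphere (0 : R4) 1 := by
    intro y
    have hy : (y : R4) ≠ 0 := y.2
    simp [norm_smul, hy]
  have he : (fun y : puncturedR4 => radialProj (y : R4)) =
      Set.codRestrict (fun y : puncturedR4 => ‖(y : R4)‖⁻¹ • (y : R4)) _ hm := by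
    ext1 y
    exact Subtype.ext (coe_radialProj y.2)
  rw [he]
  exact h.codRestrict_sphere (n := 3) hm

theorem contDiffAt_radialExt {f : S3 → ℝ} (hf : SmoothS3 f) {y : R4} (hy : y ≠ 0) :
    ContDiffAt ℝ ∞ (radialExt f) y := by
  rw [← contMDiffAt_iff_contDiffAt]
  exact contMDiffAt_subtype_iff (U := puncturedR4) (x := ⟨y, hy⟩) |>.1
    ((hf.comp contMDiff_radialProj_subtype) _)

theorem differentiableAt_radialExt {f : S3 → ℝ} (hf : SmoothS3 f) {y : R4} (hy : y ≠ 0) :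
    DifferentiableAt ℝ (radialExt f) y :=
  (contDiffAt_radialExt hf hy).differentiableAt (by simp)

/-- Euler's identity in degree zero. -/
theorem fderiv_self_of_homogeneous {V : Type*} [NormedAddCommGroup V] [NormedSpace ℝ V]
    {F : R4 → V} (hF : ∀ c : ℝ, 0 < c → ∀ y, F (c • y) = F y) {y : R4}
    (hd : DifferentiableAt ℝ F y) : fderiv ℝ F y y = 0 := by
  have h1 : HasDerivAt (fun t : ℝ => y + t • y) y 0 := by
    simpa using ((hasDerivAt_id (0 : ℝ)).smul_const y).const_add y
  have h2 : HasDerivAt (fun t : ℝ => F (y + t • y)) (fderiv ℝ F y y) 0 := by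
    have : HasFDerivAt F (fderiv ℝ F y) (y + (0 : ℝ) • y) := by
      simpa using hd.hasFDerivAt
    exact this.comp_hasDerivAt (0 : ℝ) h1
  have h3 : (fun t : ℝ => F (y + t • y)) =ᶠ[nhds 0] fun _ => F y := by
    -- Homogeneity applies only while the factor `1 + t` is positive.
    filter_upwards [lt_mem_nhds (show (-1 : ℝ) < 0 by norm_num)] with t ht
    have : y + t • y = (1 + t) • y := by rw [add_smul, one_smul]
    rw [this, hF _ (by linarith)]
  exact h2.unique ((hasDerivAt_const (0 : ℝ) (F y)).congr_of_eventuallyEq h3)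

/-- The differential of a function which is homogeneous of degree zero has degree `-1`. -/
theorem smul_fderiv_smul_of_homogeneous {V : Type*} [NormedAddCommGroup V] [NormedSpace ℝ V]
    {F : R4 → V} (hF : ∀ c : ℝ, 0 < c → ∀ y, F (c • y) = F y) {c : ℝ} (hc : 0 < c) {y : R4}
    (hd : DifferentiableAt ℝ F y) : c • fderiv ℝ F (c • y) = fderiv ℝ F y := by
  have hc' : c ≠ 0 := hc.ne'
  have h1 : HasFDerivAt (fun z : R4 => c⁻¹ • z) (c⁻¹ • ContinuousLinearMap.id ℝ R4) (c • y) :=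
    (hasFDerivAt_id (c • y)).const_smul c⁻¹
  have h2 : HasFDerivAt F (fderiv ℝ F y) (c⁻¹ • c • y) := by
    rw [smul_smul, inv_mul_cancel₀ hc', one_smul]; exact hd.hasFDerivAt
  have h3 := h2.comp (c • y) h1
  have h4 : F ∘ (fun z : R4 => c⁻¹ • z) = F := by
    ext z; exact hF _ (inv_pos.2 hc) z
  rw [h4] at h3
  rw [h3.fderiv]
  ext v
  simp [hc']

theorem mdifferentiableAt_coe_S3 (x : S3) :
    MDifferentiableAt (𝓡 3) 𝓘(ℝ, R4) ((↑) : S3 → R4) x :=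
  (contMDiff_coe_sphere (n := 3) (m := ∞) (E := R4) x).mdifferentiableAt (by simp)

theorem diffS3_eq_of_comp {f : S3 → ℝ} {F : R4 → ℝ} (hF : ∀ x : S3, F x = f x) (x : S3)
    (hd : DifferentiableAt ℝ F x) (w : TangentSpace (𝓡 3) x) :
    diffS3 f x w = fderiv ℝ F x (inclDeriv x w) := by
  have h : f = F ∘ ((↑) : S3 → R4) := by ext x; exact (hF x).symm
  rw [diffS3, h, mvfderiv_comp_apply x hd.mdifferentiableAt (mdifferentiableAt_coe_S3 x)]
  rw [mvfderiv, mfderiv_eq_fderiv]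
  rfl

theorem gradS3_eq_of_isGradS3 {f : S3 → ℝ} {x : S3} {v : R4} (h : IsGradS3 f x v) :
    gradS3 f x = v :=
  (existsUnique_isGradS3 f x).unique (isGradS3_gradS3 f x) h

/-- The tangential part of `v` is handled by the definition of the gradient; the radial part
contributes zero on both sides, because the extension is constant on rays. This reduces calculus on
the sphere to calculus in `ℝ⁴`. -/
theorem inner_gradS3 {f : S3 → ℝ} (hf : SmoothS3 f) (x : S3) (v : R4) :
    inner ℝ (gradS3 f x) v = fderiv ℝ (radialExt f) x v := by
  have hd := differentiableAt_radialExt hf (S3_ne_zero x)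
  obtain ⟨h1, h2⟩ := isGradS3_gradS3 f x
  have hv : v - inner ℝ (x : R4) v • (x : R4) ∈ (inclDeriv x).range := by
    rw [range_inclDeriv, Submodule.mem_orthogonal_singleton_iff_inner_right, inner_sub_right,
      inner_smul_right, real_inner_self_eq_norm_sq, norm_S3]
    ring
  obtain ⟨w, hw⟩ := hv
  have hw' : inclDeriv x w = v - inner ℝ (x : R4) v • (x : R4) := hw
  have h3 := h2 w
  rw [diffS3_eq_of_comp (radialExt_coe f) x hd, hw', inner_sub_right, inner_smul_right, h1,
    map_sub, map_smul, fderiv_self_of_homogeneous (fun c hc => radialExt_smul f hc) hd] at h3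
  simpa using h3

theorem inner_gradS3_self (f : S3 → ℝ) (x : S3) : inner ℝ (gradS3 f x) (x : R4) = 0 :=
  (isGradS3_gradS3 f x).1

/-! ### Rotation flows and invariance of the volume measure -/

/-- A complex structure on `ℝ⁴` which is compatible with the inner product. -/
structure IsOrthComplexStructure (A : R4 →L[ℝ] R4) : Prop where
  apply_apply : ∀ y, A (A y) = -y
  norm_apply : ∀ y, ‖A y‖ = ‖y‖
  inner_apply_self : ∀ y, inner ℝ y (A y) = 0

theorem isOrthComplexStructure_quatI : IsOrthComplexStructure quatI :=
  ⟨quatI_quatI, norm_quatI, inner_quatI_self⟩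
theorem isOrthComplexStructure_quatJ : IsOrthComplexStructure quatJ :=
  ⟨quatJ_quatJ, norm_quatJ, inner_quatJ_self⟩
theorem isOrthComplexStructure_quatK : IsOrthComplexStructure quatK :=
  ⟨quatK_quatK, norm_quatK, inner_quatK_self⟩

/-- The flow `y ↦ cos t y + sin t A y` generated by `A`. -/
noncomputable def rotFlow (A : R4 →L[ℝ] R4) (t : ℝ) (y : R4) : R4 :=
  Real.cos t • y + Real.sin t • A y

theorem norm_rotFlow {A : R4 →L[ℝ] R4} (hA : IsOrthComplexStructure A) (t : ℝ) (y : R4) :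
    ‖rotFlow A t y‖ = ‖y‖ := by
  rw [← sq_eq_sq₀ (norm_nonneg _) (norm_nonneg _), rotFlow, norm_add_sq_real, norm_smul, norm_smul,
    inner_smul_left, inner_smul_right, hA.inner_apply_self, hA.norm_apply, mul_pow, mul_pow,
    Real.norm_eq_abs, Real.norm_eq_abs, sq_abs, sq_abs]
  linear_combination ‖y‖ ^ 2 * Real.sin_sq_add_cos_sq t

theorem rotFlow_ne_zero {A : R4 →L[ℝ] R4} (hA : IsOrthComplexStructure A) (t : ℝ) {y : R4}
    (hy : y ≠ 0) : rotFlow A t y ≠ 0 := by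
  rw [← norm_ne_zero_iff, norm_rotFlow hA]
  exact norm_ne_zero_iff.2 hy

/-- The flow generated by `A`, as a linear isometry. -/
noncomputable def rotFlowIsometry {A : R4 →L[ℝ] R4} (hA : IsOrthComplexStructure A) (t : ℝ) :
    R4 ≃ₗᵢ[ℝ] R4 :=
  LinearIsometry.toLinearIsometryEquiv
    { toFun := rotFlow A t
      map_add' := fun x y => by simp only [rotFlow, map_add, smul_add]; abel
      map_smul' := fun c y => by
        simp only [rotFlow, map_smul, smul_add, smul_comm c, RingHom.id_apply]
      norm_map' := norm_rotFlow hA t } rfl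

/-- The restriction of a linear isometry to the sphere. -/
noncomputable def sphereMap (e : R4 ≃ₗᵢ[ℝ] R4) (x : S3) : S3 := ⟨e x, by simp⟩

theorem continuous_sphereMap (e : R4 ≃ₗᵢ[ℝ] R4) : Continuous (sphereMap e) :=
  (e.continuous.comp continuous_subtype_val).subtype_mk _

theorem sphereMap_injective (e : R4 ≃ₗᵢ[ℝ] R4) : Function.Injective (sphereMap e) :=
  fun _ _ h => Subtype.ext (e.injective (congrArg Subtype.val h))

instance isFiniteMeasure_volS3 : IsFiniteMeasure volS3 := by
  unfold volS3; infer_instance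

instance isOpenPosMeasure_volS3 : volS3.IsOpenPosMeasure := by
  unfold volS3; infer_instance

/-- The measure of a subset of the sphere is a multiple of the Lebesgue measure of the cone over it,
and a linear isometry carries cones to cones and preserves Lebesgue measure. -/
theorem measurePreserving_sphereMap (e : R4 ≃ₗᵢ[ℝ] R4) :
    MeasurePreserving (sphereMap e) volS3 volS3 := by
  have hm := (continuous_sphereMap e).measurable
  refine ⟨hm, Measure.ext fun s hs => ?_⟩
  rw [Measure.map_apply hm hs, volS3, Measure.toSphere_apply' _ hs,
    Measure.toSphere_apply' _ (hm hs)]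
  congr 1
  refine Eq.trans ?_
    (e.measurePreserving.measure_preimage_emb e.toHomeomorph.measurableEmbedding _)
  congr 1
  ext y
  simp only [Set.mem_smul, Set.mem_preimage, Set.mem_image]
  constructor
  · rintro ⟨r, hr, _, ⟨x, hx, rfl⟩, h⟩
    exact ⟨r, hr, _, ⟨sphereMap e x, hx, rfl⟩, (map_smul e r (x : R4)).symm.trans (congrArg e h)⟩
  · rintro ⟨r, hr, _, ⟨x, hx, rfl⟩, h⟩
    refine ⟨r, hr, _, ⟨sphereMap e.symm x, ?_, rfl⟩, ?_⟩
    · have : sphereMap e (sphereMap e.symm x) = x := Subtype.ext (e.apply_symm_apply _)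
      rwa [this]
    · apply e.injective
      rw [← h, map_smul]
      congr 1
      exact e.apply_symm_apply _

theorem integral_sphereMap (e : R4 ≃ₗᵢ[ℝ] R4) (G : S3 → ℝ) :
    ∫ x, G (sphereMap e x) ∂volS3 = ∫ x, G x ∂volS3 :=
  (measurePreserving_sphereMap e).integral_comp
    ((continuous_sphereMap e).measurableEmbedding (sphereMap_injective e)) G

theorem integrable_S3 {G : S3 → ℝ} (hG : Continuous G) : Integrable G volS3 :=
  hG.integrable_of_hasCompactSupport (HasCompactSupport.of_compactSpace G)

theorem eq_zero_of_integral_S3_eq_zero {G : S3 → ℝ} (hG : Continuous G) (h0 : ∀ x, 0 ≤ G x)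
    (hi : ∫ x, G x ∂volS3 = 0) (x : S3) : G x = 0 := by
  have h := (integral_eq_zero_iff_of_nonneg h0 (integrable_S3 hG)).1 hi
  exact congrFun ((Continuous.ae_eq_iff_eq volS3 hG continuous_const).1 h) x

theorem continuous_rotFlow (A : R4 →L[ℝ] R4) :
    Continuous fun p : ℝ × R4 => rotFlow A p.1 p.2 := by
  unfold rotFlow; fun_prop

theorem continuous_comp_rotFlow {A : R4 →L[ℝ] R4} (hA : IsOrthComplexStructure A) {G : R4 → ℝ}
    (hG : ∀ y ≠ 0, ContinuousAt G y) :
    Continuous fun p : ℝ × S3 => G (rotFlow A p.1 p.2) := by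
  rw [continuous_iff_continuousAt]
  intro p
  refine ContinuousAt.comp (g := G) (f := fun p : ℝ × S3 => rotFlow A p.1 p.2)
    (hG _ (rotFlow_ne_zero hA _ (S3_ne_zero p.2))) ?_
  exact ((continuous_rotFlow A).comp
    (continuous_fst.prodMk (continuous_subtype_val.comp continuous_snd))).continuousAt

theorem continuous_restrict_S3 {G : R4 → ℝ} (hG : ∀ y ≠ 0, ContinuousAt G y) :
    Continuous fun x : S3 => G x := by
  rw [continuous_iff_continuousAt]
  intro x
  exact ContinuousAt.comp (g := G) (hG _ (S3_ne_zero x)) continuous_subtype_val.continuousAt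

/-- The integral over the sphere is the integral of the averages over the orbits. -/
theorem integral_orbit {A : R4 →L[ℝ] R4} (hA : IsOrthComplexStructure A) {G : R4 → ℝ}
    (hG : ∀ y ≠ 0, ContinuousAt G y) :
    ∫ x : S3, (∫ t in (0 : ℝ)..2 * Real.pi, G (rotFlow A t x)) ∂volS3 =
      2 * Real.pi * ∫ x : S3, G x ∂volS3 := by
  -- After Fubini, invariance makes the inner integral independent of `t`.
  rw [← intervalIntegral_integral_swap]
  · have h : ∀ t : ℝ, ∫ x : S3, G (rotFlow A t x) ∂volS3 = ∫ x : S3, G x ∂volS3 := fun t =>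
      integral_sphereMap (rotFlowIsometry hA t) (fun x : S3 => G x)
    simp only [h, intervalIntegral.integral_const, smul_eq_mul, sub_zero]
  · have hc := continuous_comp_rotFlow hA hG
    have h1 : IntegrableOn (fun p : ℝ × S3 => G (rotFlow A p.1 p.2))
        (Set.Icc (0 : ℝ) (2 * Real.pi) ×ˢ Set.univ) (volume.prod volS3) :=
      hc.continuousOn.integrableOn_compact (isCompact_Icc.prod isCompact_univ)
    have h2 : (volume.restrict (Set.uIoc (0 : ℝ) (2 * Real.pi))).prod volS3 =
        (volume.prod volS3).restrict (Set.uIoc (0 : ℝ) (2 * Real.pi) ×ˢ Set.univ) := by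
      rw [← Measure.prod_restrict, Measure.restrict_univ]
    rw [h2]
    refine h1.mono_set (Set.prod_mono ?_ subset_rfl)
    rw [Set.uIoc_of_le (by positivity)]
    exact Set.Ioc_subset_Icc_self

/-! ### Derivatives along Killing fields and integration by parts -/

theorem hasDerivAt_rotFlow {A : R4 →L[ℝ] R4} (hA : IsOrthComplexStructure A) (t : ℝ) (y : R4) :
    HasDerivAt (fun s => rotFlow A s y) (A (rotFlow A t y)) t := by
  have h := ((Real.hasDerivAt_cos t).smul_const y).add ((Real.hasDerivAt_sin t).smul_const (A y))
  refine h.congr_deriv ?_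
  rw [rotFlow, map_add, map_smul, map_smul, hA.apply_apply, smul_neg, neg_smul, add_comm]

/-- Functions on `ℝ⁴` which are smooth off the origin. -/
def SmoothOffZero (F : R4 → ℝ) : Prop := ∀ y ≠ 0, ContDiffAt ℝ ∞ F y

/-- The derivative of `F` along the linear vector field `A`. -/
noncomputable def rotDeriv (A : R4 →L[ℝ] R4) (F : R4 → ℝ) (y : R4) : ℝ := fderiv ℝ F y (A y)

theorem SmoothOffZero.differentiableAt {F : R4 → ℝ} (hF : SmoothOffZero F) {y : R4} (hy : y ≠ 0) :
    DifferentiableAt ℝ F y := (hF y hy).differentiableAt (by simp)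

theorem SmoothOffZero.fderiv {F : R4 → ℝ} (hF : SmoothOffZero F) {y : R4} (hy : y ≠ 0) :
    ContDiffAt ℝ ∞ (fderiv ℝ F) y := (hF y hy).fderiv_right (by simp)

theorem SmoothOffZero.continuousAt {F : R4 → ℝ} (hF : SmoothOffZero F) (y : R4) (hy : y ≠ 0) :
    ContinuousAt F y := (hF y hy).continuousAt

theorem SmoothOffZero.rotDeriv {F : R4 → ℝ} (hF : SmoothOffZero F) (A : R4 →L[ℝ] R4) :
    SmoothOffZero (rotDeriv A F) := fun _ hy =>
  (hF.fderiv hy).clm_apply A.contDiff.contDiffAt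

theorem SmoothOffZero.mul {F H : R4 → ℝ} (hF : SmoothOffZero F) (hH : SmoothOffZero H) :
    SmoothOffZero (fun y => F y * H y) := fun y hy => (hF y hy).mul (hH y hy)

theorem SmoothOffZero.integrable {F : R4 → ℝ} (hF : SmoothOffZero F) :
    Integrable (fun x : S3 => F x) volS3 :=
  integrable_S3 (continuous_restrict_S3 hF.continuousAt)

theorem smoothOffZero_radialExt {f : S3 → ℝ} (hf : SmoothS3 f) : SmoothOffZero (radialExt f) :=
  fun _ hy => contDiffAt_radialExt hf hy

theorem hasDerivAt_comp_rotFlow {A : R4 →L[ℝ] R4} (hA : IsOrthComplexStructure A) {F : R4 → ℝ}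
    (hF : SmoothOffZero F) {y : R4} (hy : y ≠ 0) (t : ℝ) :
    HasDerivAt (fun s => F (rotFlow A s y)) (rotDeriv A F (rotFlow A t y)) t :=
  (hF.differentiableAt (rotFlow_ne_zero hA t hy)).hasFDerivAt.comp_hasDerivAt t
    (hasDerivAt_rotFlow hA t y)

theorem rotFlow_zero (A : R4 →L[ℝ] R4) (y : R4) : rotFlow A 0 y = y := by simp [rotFlow]

theorem rotFlow_two_pi (A : R4 →L[ℝ] R4) (y : R4) : rotFlow A (2 * Real.pi) y = y := by
  simp [rotFlow]

theorem rotFlow_pi (A : R4 →L[ℝ] R4) (y : R4) : rotFlow A Real.pi y = -y := by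
  simp [rotFlow]

theorem continuous_orbit {A : R4 →L[ℝ] R4} (hA : IsOrthComplexStructure A) {G : R4 → ℝ}
    (hG : ∀ y ≠ 0, ContinuousAt G y) (x : S3) : Continuous fun t : ℝ => G (rotFlow A t x) := by
  rw [continuous_iff_continuousAt]
  intro t
  exact ContinuousAt.comp (g := G) (f := fun t : ℝ => rotFlow A t x)
    (hG _ (rotFlow_ne_zero hA t (S3_ne_zero x))) (hasDerivAt_rotFlow hA t x).continuousAt

/-- Along each orbit the integrand is the derivative of a `2π`-periodic function, so every orbit
integral vanishes. -/
theorem integral_rotDeriv {A : R4 →L[ℝ] R4} (hA : IsOrthComplexStructure A) {F : R4 → ℝ}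
    (hF : SmoothOffZero F) : ∫ x : S3, rotDeriv A F x ∂volS3 = 0 := by
  have h := integral_orbit hA (hF.rotDeriv A).continuousAt
  have h0 : ∀ x : S3, ∫ t in (0 : ℝ)..2 * Real.pi, rotDeriv A F (rotFlow A t x) = 0 := by
    intro x
    rw [intervalIntegral.integral_eq_sub_of_hasDerivAt
      (fun t _ => hasDerivAt_comp_rotFlow hA hF (S3_ne_zero x) t)
      ((continuous_orbit hA (hF.rotDeriv A).continuousAt x).intervalIntegrable _ _),
      rotFlow_two_pi, rotFlow_zero, sub_self]
  simp only [h0, integral_zero] at h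
  rcases mul_eq_zero.1 h.symm with h | h
  · exact absurd h (by positivity)
  · exact h

theorem rotDeriv_mul (A : R4 →L[ℝ] R4) {F H : R4 → ℝ} (hF : SmoothOffZero F)
    (hH : SmoothOffZero H) {y : R4} (hy : y ≠ 0) :
    rotDeriv A (fun z => F z * H z) y = F y * rotDeriv A H y + rotDeriv A F y * H y := by
  rw [rotDeriv, fderiv_fun_mul (hF.differentiableAt hy) (hH.differentiableAt hy)]
  simp [rotDeriv]; ring

/-- Integration by parts along the Killing field `A`. -/
theorem integral_mul_rotDeriv {A : R4 →L[ℝ] R4} (hA : IsOrthComplexStructure A) {F H : R4 → ℝ}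
    (hF : SmoothOffZero F) (hH : SmoothOffZero H) :
    ∫ x : S3, rotDeriv A F x * H x ∂volS3 = -∫ x : S3, F x * rotDeriv A H x ∂volS3 := by
  have h := integral_rotDeriv hA (hF.mul hH)
  have h1 : ∀ x : S3, rotDeriv A (fun z => F z * H z) x =
      F x * rotDeriv A H x + rotDeriv A F x * H x := fun x => rotDeriv_mul A hF hH (S3_ne_zero x)
  simp only [h1] at h
  rw [integral_add (hF.mul (hH.rotDeriv A)).integrable ((hF.rotDeriv A).mul hH).integrable] at h
  linarith

theorem rotDeriv_rotDeriv {A B : R4 →L[ℝ] R4} {F : R4 → ℝ} (hF : SmoothOffZero F) {y : R4}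
    (hy : y ≠ 0) : rotDeriv A (rotDeriv B F) y =
      fderiv ℝ (fderiv ℝ F) y (A y) (B y) + fderiv ℝ F y (B (A y)) := by
  have h1 : HasFDerivAt (fderiv ℝ F) (fderiv ℝ (fderiv ℝ F) y) y :=
    ((hF.fderiv hy).differentiableAt (by simp)).hasFDerivAt
  have h2 := h1.clm_apply (B.hasFDerivAt (x := y))
  rw [rotDeriv]
  change fderiv ℝ (fun z => fderiv ℝ F z (B z)) y (A y) = _
  rw [h2.fderiv]
  simp [add_comm]

/-- Second-order terms cancel by symmetry of the Hessian. What remains is the matrix commutator, in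
the order opposite to that of the derivations. -/
theorem rotDeriv_comm {A B C : R4 →L[ℝ] R4} (hC : ∀ y, B (A y) - A (B y) = C y) {F : R4 → ℝ}
    (hF : SmoothOffZero F) {y : R4} (hy : y ≠ 0) :
    rotDeriv A (rotDeriv B F) y - rotDeriv B (rotDeriv A F) y = rotDeriv C F y := by
  have hs : IsSymmSndFDerivAt ℝ F y := (hF y hy).isSymmSndFDerivAt
    (by simpa using WithTop.coe_le_coe.2 (le_top : (2 : ℕ∞) ≤ ⊤))
  rw [rotDeriv_rotDeriv hF hy, rotDeriv_rotDeriv hF hy, hs.eq (A y) (B y), rotDeriv, ← hC, map_sub]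
  ring

/-- The Kähler form integrates to twice the pairing of `f` with the Hopf derivative of `h`. -/
theorem integral_bracket {F H : R4 → ℝ} (hF : SmoothOffZero F) (hH : SmoothOffZero H) :
    ∫ x : S3, (rotDeriv quatJ F x * rotDeriv quatK H x -
      rotDeriv quatK F x * rotDeriv quatJ H x) ∂volS3 =
      2 * ∫ x : S3, F x * rotDeriv quatI H x ∂volS3 := by
  have hJ := isOrthComplexStructure_quatJ
  have hK := isOrthComplexStructure_quatK
  rw [integral_sub ((hF.rotDeriv _).mul (hH.rotDeriv _)).integrable
    ((hF.rotDeriv _).mul (hH.rotDeriv _)).integrable,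
    integral_mul_rotDeriv hJ hF (hH.rotDeriv _), integral_mul_rotDeriv hK hF (hH.rotDeriv _),
    sub_neg_eq_add, neg_add_eq_sub,
    ← integral_sub (hF.mul ((hH.rotDeriv _).rotDeriv _)).integrable
    (hF.mul ((hH.rotDeriv _).rotDeriv _)).integrable, ← integral_const_mul]
  congr 1
  ext x
  have hc : ∀ y, quatJ (quatK y) - quatK (quatJ y) = ((2 : ℝ) • quatI) y := by
    intro y
    rw [quatJ_quatK, quatK_quatJ, sub_neg_eq_add, ← two_smul ℝ]
    rfl
  have h := rotDeriv_comm hc hH (S3_ne_zero x)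
  have h2 : rotDeriv ((2 : ℝ) • quatI) H x = 2 * rotDeriv quatI H x := by simp [rotDeriv]
  rw [h2] at h
  linear_combination F x * h

/-! ### Fourier series on a Hopf circle -/

theorem memLp_two_Ioc_of_continuous {g : ℝ → ℂ} (hg : Continuous g) (a b : ℝ) :
    MemLp g 2 (volume.restrict (Set.Ioc a b)) := by
  rw [memLp_two_iff_integrable_sq_norm hg.aestronglyMeasurable]
  exact ((hg.norm.pow 2).integrableOn_Icc).mono_set Set.Ioc_subset_Icc_self

theorem fourierCoeffOn_linear_comb {a b : ℝ} (hab : a < b) {g k : ℝ → ℂ} (hg : Continuous g)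
    (hk : Continuous k) (c : ℂ) (n : ℤ) :
    fourierCoeffOn hab (fun t => g t - c * k t) n =
      fourierCoeffOn hab g n - c * fourierCoeffOn hab k n := by
  have hc : Continuous fun t : ℝ => fourier (-n) (t : AddCircle (b - a)) :=
    (map_continuous _).comp continuous_quotient_mk'
  simp only [fourierCoeffOn_eq_integral, smul_eq_mul, mul_sub]
  have h1 : Continuous fun t : ℝ => fourier (-n) (t : AddCircle (b - a)) * g t := hc.mul hg
  have h2 : Continuous fun t : ℝ => fourier (-n) (t : AddCircle (b - a)) * (c * k t) :=
    hc.mul (continuous_const.mul hk)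
  rw [intervalIntegral.integral_sub (h1.intervalIntegrable _ _) (h2.intervalIntegrable _ _),
    smul_sub]
  congr 1
  simp only [mul_left_comm _ c]
  rw [intervalIntegral.integral_const_mul, mul_smul_comm]

theorem fourierCoeffOn_deriv {g g' : ℝ → ℂ} (hg : ∀ t, HasDerivAt g (g' t) t)
    (hg' : Continuous g') (hper : g (2 * Real.pi) = g 0) (n : ℤ) :
    fourierCoeffOn Real.two_pi_pos g' n =
      Complex.I * n * fourierCoeffOn Real.two_pi_pos g n := by
  rcases eq_or_ne n 0 with rfl | hn
  · rw [fourierCoeffOn_eq_integral]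
    simp only [neg_zero, fourier_zero, one_smul, Int.cast_zero, mul_zero, zero_mul]
    rw [intervalIntegral.integral_eq_sub_of_hasDerivAt (fun t _ => hg t)
      (hg'.intervalIntegrable _ _), hper, sub_self, smul_zero]
  · rw [fourierCoeffOn_of_hasDerivAt Real.two_pi_pos hn (fun t _ => hg t)
      (hg'.intervalIntegrable _ _), hper]
    have h1 : (n : ℂ) ≠ 0 := by exact_mod_cast hn
    have h2 : (Real.pi : ℂ) ≠ 0 := by exact_mod_cast Real.pi_ne_zero
    push_cast
    field_simp
    ring_nf

theorem fourierCoeffOn_exp (m n : ℤ) :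
    fourierCoeffOn Real.two_pi_pos (fun t : ℝ => Complex.exp (m * t * Complex.I)) n =
      if n = m then 1 else 0 := by
  have hpi : (Real.pi : ℂ) ≠ 0 := by exact_mod_cast Real.pi_ne_zero
  have hpi' : Real.pi ≠ 0 := Real.pi_ne_zero
  rw [fourierCoeffOn_eq_integral]
  have h : ∀ t : ℝ, fourier (-n) (t : AddCircle (2 * Real.pi - 0)) •
      Complex.exp (m * t * Complex.I) = Complex.exp (((m - n : ℤ) * Complex.I) * t) := by
    intro t
    rw [fourier_coe_apply, smul_eq_mul, ← Complex.exp_add]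
    congr 1
    push_cast
    field_simp
    ring
  simp only [h]
  split_ifs with hnm
  · subst hnm
    simp only [sub_self, Int.cast_zero, zero_mul, Complex.exp_zero,
      intervalIntegral.integral_const, smul_smul, sub_zero]
    rw [one_div, inv_mul_cancel₀ (by positivity), one_smul]
  · have hmn : ((m - n : ℤ) : ℂ) ≠ 0 := by
      rw [Int.cast_ne_zero]; omega
    rw [integral_exp_mul_complex (mul_ne_zero hmn Complex.I_ne_zero)]
    have h1 : Complex.exp (((m - n : ℤ) : ℂ) * Complex.I * ((2 * Real.pi : ℝ) : ℂ)) = 1 := by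
      rw [← Complex.exp_int_mul_two_pi_mul_I (m - n)]
      congr 1
      push_cast; ring
    rw [h1]
    simp

/-- Parseval's identity for the quadratic form of the operator `T(T - 1)`, `T = -i d/dt`. -/
theorem hasSum_shifted_energy {g g' : ℝ → ℂ} (hg : ∀ t, HasDerivAt g (g' t) t)
    (hg' : Continuous g') (hper : g (2 * Real.pi) = g 0) :
    HasSum (fun n : ℤ => ((n : ℝ) ^ 2 - n) * ‖fourierCoeffOn Real.two_pi_pos g n‖ ^ 2)
      ((2 * Real.pi)⁻¹ * ∫ t in (0 : ℝ)..2 * Real.pi,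
        (‖g' t - Complex.I / 2 * g t‖ ^ 2 - 1 / 4 * ‖g t‖ ^ 2)) := by
  have hgc : Continuous g := continuous_iff_continuousAt.2 fun t => (hg t).continuousAt
  have hkc : Continuous fun t => g' t - Complex.I / 2 * g t := by fun_prop
  have h1 := hasSum_sq_fourierCoeffOn Real.two_pi_pos (memLp_two_Ioc_of_continuous hgc _ _)
  have h2 := hasSum_sq_fourierCoeffOn Real.two_pi_pos (memLp_two_Ioc_of_continuous hkc _ _)
  have hterm : ∀ n : ℤ, ((n : ℝ) ^ 2 - n) * ‖fourierCoeffOn Real.two_pi_pos g n‖ ^ 2 =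
      ‖fourierCoeffOn Real.two_pi_pos (fun t => g' t - Complex.I / 2 * g t) n‖ ^ 2 -
        1 / 4 * ‖fourierCoeffOn Real.two_pi_pos g n‖ ^ 2 := by
    intro n
    rw [fourierCoeffOn_linear_comb _ hg' hgc, fourierCoeffOn_deriv hg hg' hper, ← sub_mul, norm_mul,
      mul_pow]
    -- Completing the square: `(n - 1/2)² - 1/4 = n² - n`, which accounts for the shift `I / 2` and
    -- the constant `1 / 4`.
    have : Complex.I * n - Complex.I / 2 = ((n - 1 / 2 : ℝ) : ℂ) * Complex.I := by
      push_cast; ring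
    rw [this, norm_mul, Complex.norm_I, Complex.norm_real, Real.norm_eq_abs, mul_one, sq_abs]
    ring
  have hsum := h2.sub (h1.mul_left (1 / 4))
  simp only [← hterm] at hsum
  have i1 : Continuous fun t => ‖g' t - Complex.I / 2 * g t‖ ^ 2 := by fun_prop
  have i2 : Continuous fun t => 1 / 4 * ‖g t‖ ^ 2 := by fun_prop
  rw [intervalIntegral.integral_sub (i1.intervalIntegrable _ _) (i2.intervalIntegrable _ _),
    intervalIntegral.integral_const_mul]
  simp only [smul_eq_mul, sub_zero] at hsum
  rwa [mul_sub, mul_left_comm (2 * Real.pi)⁻¹ (1 / 4)]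

/-- No integer lies strictly between the roots 0 and 1. This integrality is the source of the sharp
constant. -/
theorem int_sq_sub_self_nonneg (n : ℤ) : 0 ≤ (n : ℝ) ^ 2 - n := by
  have : (0 : ℤ) ≤ n ^ 2 - n := by
    rcases le_or_gt n 0 with h | h <;> nlinarith
  exact_mod_cast this

theorem shifted_energy_nonneg {g g' : ℝ → ℂ} (hg : ∀ t, HasDerivAt g (g' t) t)
    (hg' : Continuous g') (hper : g (2 * Real.pi) = g 0) :
    0 ≤ ∫ t in (0 : ℝ)..2 * Real.pi,
        (‖g' t - Complex.I / 2 * g t‖ ^ 2 - 1 / 4 * ‖g t‖ ^ 2) := by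
  have h := (hasSum_shifted_energy hg hg' hper).nonneg
    fun n => mul_nonneg (int_sq_sub_self_nonneg n) (sq_nonneg _)
  exact nonneg_of_mul_nonneg_right h (by positivity)

/-- The weight `n² - n` vanishes only at 0 and 1, so a vanishing sum of nonnegative terms kills
every other Fourier coefficient. -/
theorem eq_of_shifted_energy_eq_zero {g g' : ℝ → ℂ} (hg : ∀ t, HasDerivAt g (g' t) t)
    (hg' : Continuous g') (hper : g (2 * Real.pi) = g 0)
    (h0 : ∫ t in (0 : ℝ)..2 * Real.pi,
        (‖g' t - Complex.I / 2 * g t‖ ^ 2 - 1 / 4 * ‖g t‖ ^ 2) = 0) :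
    ∃ a b : ℂ, ∀ t ∈ Set.Icc 0 (2 * Real.pi), g t = a + b * Complex.exp (t * Complex.I) := by
  have hgc : Continuous g := continuous_iff_continuousAt.2 fun t => (hg t).continuousAt
  have h := hasSum_shifted_energy hg hg' hper
  rw [h0, mul_zero, hasSum_zero_iff_of_nonneg
    fun n => mul_nonneg (int_sq_sub_self_nonneg n) (sq_nonneg _)] at h
  have hc : ∀ n : ℤ, n ≠ 0 → n ≠ 1 → fourierCoeffOn Real.two_pi_pos g n = 0 := by
    intro n hn0 hn1
    have h1 := congrFun h n
    simp only [Pi.zero_apply, mul_eq_zero, ne_eq, OfNat.ofNat_ne_zero, not_false_eq_true,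
      pow_eq_zero_iff, norm_eq_zero] at h1
    refine h1.resolve_left fun h2 => ?_
    have h3 : n * (n - 1) = 0 := by
      have : (n : ℝ) * (n - 1) = 0 := by linear_combination h2
      exact_mod_cast this
    rcases mul_eq_zero.1 h3 with h4 | h4 <;> omega
  set a := fourierCoeffOn Real.two_pi_pos g 0
  set b := fourierCoeffOn Real.two_pi_pos g 1
  refine ⟨a, b, ?_⟩
  let e : ℤ → ℝ → ℂ := fun m t => Complex.exp (m * t * Complex.I)
  have he : ∀ m, Continuous (e m) := fun m => by fun_prop
  -- Once both modes are removed no coefficient is left. Parseval gives `∫ ‖r‖² = 0`, and continuity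
  -- upgrades this to `r = 0` at every point of the closed interval.
  let r : ℝ → ℂ := fun t => (g t - a * e 0 t) - b * e 1 t
  have hgc' : Continuous fun t => g t - a * e 0 t := hgc.sub (continuous_const.mul (he 0))
  have hr : Continuous r := hgc'.sub (continuous_const.mul (he 1))
  have hr0 : ∀ n, fourierCoeffOn Real.two_pi_pos r n = 0 := by
    intro n
    rw [fourierCoeffOn_linear_comb _ hgc' (he 1), fourierCoeffOn_linear_comb _ hgc (he 0),
      fourierCoeffOn_exp, fourierCoeffOn_exp]
    by_cases hn0 : n = 0
    · subst hn0; simp [a]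
    · by_cases hn1 : n = 1
      · subst hn1; simp [b]
      · simp [hn0, hn1, hc n hn0 hn1]
  have hp := hasSum_sq_fourierCoeffOn Real.two_pi_pos (memLp_two_Ioc_of_continuous hr _ _)
  simp only [hr0, norm_zero, ne_eq, OfNat.ofNat_ne_zero, not_false_eq_true, zero_pow] at hp
  have hint : ∫ t in (0 : ℝ)..2 * Real.pi, ‖r t‖ ^ 2 = 0 := by
    have := hp.unique hasSum_zero
    simpa [Real.pi_ne_zero] using this
  intro t ht
  by_contra hne
  have hrt : r t ≠ 0 := by
    intro hz
    apply hne
    have : g t - a * e 0 t - b * e 1 t = 0 := hz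
    simp only [e, Int.cast_zero, zero_mul, Complex.exp_zero, Int.cast_one, one_mul] at this
    linear_combination this
  have hpos := intervalIntegral.integral_pos Real.two_pi_pos
    (hr.norm.pow 2).continuousOn (fun x _ => sq_nonneg ‖r x‖)
    ⟨t, ht, pow_pos (norm_pos_iff.2 hrt) 2⟩
  simp only [Pi.pow_apply] at hpos
  exact hpos.ne' hint

/-! ### Homogeneous holomorphic functions on `ℂ² \ {0}` -/

/-- The identification of `ℂ²` with `ℝ⁴`. -/
noncomputable def ofC2 (z w : ℂ) : R4 := !₂[z.re, z.im, w.re, w.im]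

/-- The identification of `{0} × ℂ` with a plane in `ℝ⁴`. -/
noncomputable def ofC2Right : ℂ →L[ℝ] R4 := LinearMap.toContinuousLinearMap
  { toFun := fun w => ofC2 0 w
    map_add' := fun x y => by ext i; fin_cases i <;> simp [ofC2]
    map_smul' := fun c y => by ext i; fin_cases i <;> simp [ofC2] }

/-- The identification of `ℂ × {0}` with a plane in `ℝ⁴`. -/
noncomputable def ofC2Left : ℂ →L[ℝ] R4 := LinearMap.toContinuousLinearMap
  { toFun := fun w => ofC2 w 0
    map_add' := fun x y => by ext i; fin_cases i <;> simp [ofC2]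
    map_smul' := fun c y => by ext i; fin_cases i <;> simp [ofC2] }

theorem ofC2_eq_add_right (z w : ℂ) : ofC2 z w = ofC2 z 0 + ofC2Right w := by
  ext i; fin_cases i <;> simp [ofC2, ofC2Right]

theorem ofC2_eq_add_left (z w : ℂ) : ofC2 z w = ofC2Left z + ofC2 0 w := by
  ext i; fin_cases i <;> simp [ofC2, ofC2Left]

theorem ofC2_ne_zero {z w : ℂ} (h : z ≠ 0 ∨ w ≠ 0) : ofC2 z w ≠ 0 := by
  intro h0
  have h1 := fun i => congrArg (fun y : R4 => y i) h0
  have hz : z = 0 := Complex.ext (by simpa [ofC2] using h1 0) (by simpa [ofC2] using h1 1)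
  have hw : w = 0 := Complex.ext (by simpa [ofC2] using h1 2) (by simpa [ofC2] using h1 3)
  tauto

theorem quatI_ofC2Right (w : ℂ) : quatI (ofC2Right w) = ofC2Right (Complex.I * w) := by
  ext i; fin_cases i <;> simp [ofC2, ofC2Right, quatI_apply]

theorem eq_ofC2 (y : R4) : y = ofC2 ⟨y 0, y 1⟩ ⟨y 2, y 3⟩ := by
  ext i; fin_cases i <;> simp [ofC2]

/-- Multiplication by a complex number is a dilation followed by a Hopf rotation; complex
homogeneity thus reduces to real homogeneity and behaviour along Hopf orbits. -/
theorem ofC2_mul (c z w : ℂ) :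
    ofC2 (c * z) (c * w) = ‖c‖ • rotFlow quatI c.arg (ofC2 z w) := by
  have hre := Complex.norm_mul_cos_arg c
  have him := Complex.norm_mul_sin_arg c
  ext i
  fin_cases i <;> simp [ofC2, rotFlow, quatI_apply] <;> rw [← hre, ← him] <;> ring

/-- The differential is complex linear at every point off the origin. -/
structure HolomorphicOffZero (U : R4 → ℂ) : Prop where
  differentiableAt : ∀ y ≠ 0, DifferentiableAt ℝ U y
  fderiv_quatI : ∀ y ≠ 0, ∀ v, fderiv ℝ U y (quatI v) = Complex.I * fderiv ℝ U y v

/-- The hypotheses are complex linearity on the complex lines `span (y, iy)` and `span (jy, ky)`,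
which together span `ℝ⁴`. -/
theorem map_quatI_of_frame {L : R4 →L[ℝ] ℂ} {y : R4} (hy : y ≠ 0)
    (h1 : L (quatI y) = Complex.I * L y) (h2 : L (quatK y) = Complex.I * L (quatJ y)) (v : R4) :
    L (quatI v) = Complex.I * L v := by
  have hn : ‖y‖ ^ 2 ≠ 0 := pow_ne_zero 2 (norm_ne_zero_iff.2 hy)
  have hv := frame_expansion y v
  have hi := congrArg quatI hv
  have e1 := congrArg L hi
  have e2 := congrArg L hv
  simp only [map_add, map_smul, quatI_quatI, quatI_quatJ, quatI_quatK, map_neg, h1, h2,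
    Complex.real_smul] at e1 e2
  have hn' : ((‖y‖ ^ 2 : ℝ) : ℂ) ≠ 0 := by exact_mod_cast hn
  apply mul_left_cancel₀ hn'
  rw [mul_left_comm, e2, e1]
  linear_combination (-(inner ℝ v (quatI y) : ℝ) * L y - (inner ℝ v (quatK y) : ℝ) * L (quatJ y)) *
    Complex.I_mul_I

theorem HolomorphicOffZero.differentiable_line {U : R4 → ℂ} (hU : HolomorphicOffZero U) :
    Differentiable ℂ fun w : ℂ => U (ofC2 1 w) := by
  intro w
  have hy : ofC2 1 w ≠ 0 := ofC2_ne_zero (Or.inl one_ne_zero)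
  have hl : HasFDerivAt (fun w : ℂ => ofC2 1 w) ofC2Right w := by
    rw [show (fun w : ℂ => ofC2 1 w) = fun w => ofC2 1 0 + ofC2Right w from
      funext (ofC2_eq_add_right 1)]
    exact ofC2Right.hasFDerivAt.const_add _
  have h := (hU.differentiableAt _ hy).hasFDerivAt.comp w hl
  refine differentiableAt_complex_iff_differentiableAt_real.2 ⟨h.differentiableAt, ?_⟩
  have h' : HasFDerivAt (fun w : ℂ => U (ofC2 1 w))
    ((fderiv ℝ U (ofC2 1 w)).comp ofC2Right) w := h
  rw [h'.fderiv]
  have := quatI_ofC2Right 1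
  rw [mul_one] at this
  simp only [ContinuousLinearMap.comp_apply, ← this, hU.fderiv_quatI _ hy, smul_eq_mul]

/-- Behaviour at the point at infinity of the projective line, read in the second affine chart. -/
theorem HolomorphicOffZero.tendsto_inv {U : R4 → ℂ} (hU : HolomorphicOffZero U) :
    Tendsto (fun w : ℂ => U (ofC2 w⁻¹ 1)) (cocompact ℂ) (𝓝 (U (ofC2 0 1))) := by
  have hy : ofC2 0 1 ≠ 0 := ofC2_ne_zero (Or.inr one_ne_zero)
  have h1 : Tendsto (fun z : ℂ => ofC2 z 1) (𝓝 0) (𝓝 (ofC2 0 1)) := by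
    have : Continuous fun z : ℂ => ofC2 z 1 := by
      rw [show (fun z : ℂ => ofC2 z 1) = fun z => ofC2Left z + ofC2 0 1 from
        funext fun z => ofC2_eq_add_left z 1]
      fun_prop
    exact this.tendsto 0
  have h2 : Tendsto (fun w : ℂ => w⁻¹) (cocompact ℂ) (𝓝 0) := by
    rw [← Metric.cobounded_eq_cocompact]
    exact tendsto_inv₀_cobounded
  exact ((hU.differentiableAt _ hy).continuousAt.tendsto.comp h1).comp h2

theorem eventually_ne_zero_cocompact : ∀ᶠ w : ℂ in cocompact ℂ, w ≠ 0 := by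
  rw [← Metric.cobounded_eq_cocompact]
  exact Bornology.eventually_ne_cobounded 0

/-- A holomorphic function on `ℂ² \ {0}` which is homogeneous of degree zero is constant. -/
theorem HolomorphicOffZero.eq_const {U : R4 → ℂ} (hU : HolomorphicOffZero U)
    (hom : ∀ c : ℂ, c ≠ 0 → ∀ z w, U (ofC2 (c * z) (c * w)) = U (ofC2 z w)) {y : R4}
    (hy : y ≠ 0) : U y = U (ofC2 0 1) := by
  -- Degree zero gives `U(1, w) = U(1/w, 1)`, so this entire function of `w` has a finite limit at
  -- infinity and Liouville's theorem applies.
  have hline : ∀ w, U (ofC2 1 w) = U (ofC2 0 1) := by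
    intro w
    refine hU.differentiable_line.apply_eq_of_tendsto_cocompact w (hU.tendsto_inv.congr' ?_)
    filter_upwards [eventually_ne_zero_cocompact] with w hw
    rw [← hom w hw, mul_inv_cancel₀ hw, mul_one]
  rw [eq_ofC2 y] at hy ⊢
  generalize (⟨y 0, y 1⟩ : ℂ) = z at *
  generalize (⟨y 2, y 3⟩ : ℂ) = w at *
  by_cases hz : z = 0
  · subst hz
    have hw : w ≠ 0 := by
      rintro rfl
      exact hy (by ext i; fin_cases i <;> simp [ofC2])
    have := hom w hw 0 1
    rwa [mul_zero, mul_one] at this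
  · have := hom z hz 1 (w / z)
    rwa [mul_one, mul_div_cancel₀ _ hz, hline] at this

/-- A holomorphic function on `ℂ² \ {0}` which is homogeneous of degree one is linear. -/
theorem HolomorphicOffZero.eq_linear {U : R4 → ℂ} (hU : HolomorphicOffZero U)
    (hom : ∀ c : ℂ, c ≠ 0 → ∀ z w, U (ofC2 (c * z) (c * w)) = c * U (ofC2 z w)) {z w : ℂ}
    (hzw : z ≠ 0 ∨ w ≠ 0) : U (ofC2 z w) = z * U (ofC2 1 0) + w * U (ofC2 0 1) := by
  set G : ℂ → ℂ := fun w => U (ofC2 1 w) with hG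
  -- In degree one, `G` grows linearly: `G w / w = U(1/w, 1)`. The difference quotient `(G w - G 0)
  -- / w` is therefore entire with a finite limit at infinity, hence constant.
  have hd : Differentiable ℂ (dslope G 0) := by
    rw [← differentiableOn_univ]
    exact (Complex.differentiableOn_dslope univ_mem).2 hU.differentiable_line.differentiableOn
  have hlim : Tendsto (dslope G 0) (cocompact ℂ) (𝓝 (U (ofC2 0 1))) := by
    have h2 : Tendsto (fun w : ℂ => w⁻¹) (cocompact ℂ) (𝓝 0) := by
      rw [← Metric.cobounded_eq_cocompact]
      exact tendsto_inv₀_cobounded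
    have h3 := hU.tendsto_inv.sub (h2.mul_const (G 0))
    rw [zero_mul, sub_zero] at h3
    refine h3.congr' ?_
    filter_upwards [eventually_ne_zero_cocompact] with w hw
    rw [dslope_of_ne _ hw, slope_def_field, sub_zero]
    have h4 : G w = w * U (ofC2 w⁻¹ 1) := by
      rw [← hom w hw, mul_inv_cancel₀ hw, mul_one]
    rw [h4]
    field_simp
  have hline : ∀ w, G w = U (ofC2 1 0) + w * U (ofC2 0 1) := by
    intro w
    have h5 := sub_smul_dslope G 0 w
    rw [hd.apply_eq_of_tendsto_cocompact w hlim, sub_zero, smul_eq_mul] at h5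
    rw [h5]
    simp [hG]
  by_cases hz : z = 0
  · subst hz
    have := hom w (by tauto) 0 1
    rw [mul_zero, mul_one] at this
    rw [this]; ring
  · have h6 := hom z hz 1 (w / z)
    rw [mul_one, mul_div_cancel₀ _ hz] at h6
    rw [h6]
    have h7 : U (ofC2 1 (w / z)) = _ := hline (w / z)
    rw [h7]
    field_simp

/-! ### Rigidity of contact holomorphic functions -/

/-- Functions of degree zero on `ℂ² \ {0}` whose differential is complex linear on the contact
planes `span (jy, ky)`, and which contain only the frequencies `0` and `1` along the Hopf circles. -/
structure IsContactHolomorphic (u : R4 → ℂ) : Prop where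
  differentiableAt : ∀ y ≠ 0, DifferentiableAt ℝ u y
  homogeneous : ∀ c : ℝ, 0 < c → ∀ y, u (c • y) = u y
  fderiv_quatK : ∀ y ≠ 0, fderiv ℝ u y (quatK y) = Complex.I * fderiv ℝ u y (quatJ y)
  orbit : ∀ y ≠ 0, ∀ t : ℝ, u (rotFlow quatI t y) =
    (u y + u (-y)) / 2 + Complex.exp (t * Complex.I) * ((u y - u (-y)) / 2)

namespace IsContactHolomorphic

variable {u : R4 → ℂ}

theorem rotFlow_neg (A : R4 →L[ℝ] R4) (t : ℝ) (y : R4) : rotFlow A t (-y) = -rotFlow A t y := by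
  simp only [rotFlow, map_neg, smul_neg]; abel

theorem hasFDerivAt_comp_neg (hu : IsContactHolomorphic u) {y : R4} (hy : y ≠ 0) :
    HasFDerivAt (fun z => u (-z)) (-fderiv ℝ u (-y)) y := by
  have h := (hu.differentiableAt (-y) (neg_ne_zero.2 hy)).hasFDerivAt.comp y
    (hasFDerivAt_id y).neg
  refine h.congr_fderiv ?_
  ext v; simp

/-- Even (`s = 1`) and odd (`s = -1`) parts. -/
theorem hasFDerivAt_part (hu : IsContactHolomorphic u) (s : ℂ) {y : R4} (hy : y ≠ 0) :
    HasFDerivAt (fun z => (u z + s * u (-z)) / 2)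
      ((1 / 2 : ℂ) • (fderiv ℝ u y + s • (-fderiv ℝ u (-y)))) y := by
  have h := (((hu.differentiableAt y hy).hasFDerivAt.add
    ((hu.hasFDerivAt_comp_neg hy).const_smul s)).const_smul (1 / 2 : ℂ))
  refine h.congr_of_eventuallyEq (Filter.Eventually.of_forall fun z => ?_)
  simp; ring

theorem fderiv_part_quatK (hu : IsContactHolomorphic u) (s : ℂ) {y : R4} (hy : y ≠ 0) :
    fderiv ℝ (fun z => (u z + s * u (-z)) / 2) y (quatK y) =
      Complex.I * fderiv ℝ (fun z => (u z + s * u (-z)) / 2) y (quatJ y) := by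
  have h1 := hu.fderiv_quatK y hy
  have h2 := hu.fderiv_quatK (-y) (neg_ne_zero.2 hy)
  simp only [map_neg] at h2
  rw [(hu.hasFDerivAt_part s hy).fderiv]
  simp only [smul_add, smul_neg, add_apply, smul_apply, neg_apply, smul_eq_mul]
  linear_combination (1 / 2 : ℂ) * h1 + s / 2 * h2

theorem fderiv_part_self (hu : IsContactHolomorphic u) (s : ℂ) {y : R4} (hy : y ≠ 0) :
    fderiv ℝ (fun z => (u z + s * u (-z)) / 2) y y = 0 :=
  fderiv_self_of_homogeneous (F := fun z => (u z + s * u (-z)) / 2)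
    (fun c hc z => by rw [← smul_neg, hu.homogeneous c hc, hu.homogeneous c hc])
    (hu.hasFDerivAt_part s hy).differentiableAt

theorem even_orbit (hu : IsContactHolomorphic u) {y : R4} (hy : y ≠ 0) (t : ℝ) :
    (u (rotFlow quatI t y) + u (-rotFlow quatI t y)) / 2 = (u y + u (-y)) / 2 := by
  rw [← rotFlow_neg, hu.orbit y hy, hu.orbit (-y) (neg_ne_zero.2 hy), neg_neg]
  ring

theorem odd_orbit (hu : IsContactHolomorphic u) {y : R4} (hy : y ≠ 0) (t : ℝ) :
    (u (rotFlow quatI t y) - u (-rotFlow quatI t y)) / 2 =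
      Complex.exp (t * Complex.I) * ((u y - u (-y)) / 2) := by
  rw [← rotFlow_neg, hu.orbit y hy, hu.orbit (-y) (neg_ne_zero.2 hy), neg_neg]
  ring

end IsContactHolomorphic

theorem fderiv_quat_of_orbit {A : R4 →L[ℝ] R4} (hA : IsOrthComplexStructure A) {V : Type*}
    [NormedAddCommGroup V] [NormedSpace ℝ V] {F : R4 → V} {y : R4} {φ : ℝ → V} {φ' : V}
    (hF : DifferentiableAt ℝ F y) (hφ : HasDerivAt φ φ' 0) (h : ∀ t, F (rotFlow A t y) = φ t) :
    fderiv ℝ F y (A y) = φ' := by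
  have h0 : HasFDerivAt F (fderiv ℝ F y) (rotFlow A 0 y) := by
    rw [rotFlow_zero]; exact hF.hasFDerivAt
  have h1 := h0.comp_hasDerivAt (0 : ℝ) (hasDerivAt_rotFlow hA 0 y)
  rw [rotFlow_zero] at h1
  have h2 : F ∘ (fun t => rotFlow A t y) = φ := funext h
  rw [h2] at h1
  exact h1.unique hφ

theorem fderiv_norm_quat {A : R4 →L[ℝ] R4} (hA : IsOrthComplexStructure A) {y : R4} (hy : y ≠ 0) :
    fderiv ℝ (fun z : R4 => ‖z‖) y (A y) = 0 :=
  fderiv_quat_of_orbit hA ((contDiffAt_norm ℝ hy (n := 1)).differentiableAt (by simp))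
    (hasDerivAt_const (0 : ℝ) ‖y‖) (fun t => norm_rotFlow hA t y)

namespace IsContactHolomorphic

variable {u : R4 → ℂ}

/-- The even part is constant both on Hopf circles and on rays, so its differential vanishes on
`span (y, iy)`; the contact plane is covered by the Cauchy-Riemann condition. -/
theorem holomorphic_even (hu : IsContactHolomorphic u) :
    HolomorphicOffZero fun y => (u y + u (-y)) / 2 := by
  have he : (fun y => (u y + u (-y)) / 2) = fun z => (u z + 1 * u (-z)) / 2 := by
    ext z; rw [one_mul]
  have hd : ∀ y ≠ 0, DifferentiableAt ℝ (fun y => (u y + u (-y)) / 2) y := fun y hy => by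
    rw [he]; exact (hu.hasFDerivAt_part 1 hy).differentiableAt
  refine ⟨hd, fun y hy => map_quatI_of_frame hy ?_ ?_⟩
  · rw [fderiv_quat_of_orbit isOrthComplexStructure_quatI (hd y hy)
      (hasDerivAt_const (0 : ℝ) ((u y + u (-y)) / 2)) (hu.even_orbit hy), he,
      hu.fderiv_part_self 1 hy, mul_zero]
  · rw [he]; exact hu.fderiv_part_quatK 1 hy

/-- The odd part has frequency 1 on Hopf circles but is constant on rays. The factor `‖y‖` gives it
radial degree 1, which restores complex linearity on `span (y, iy)`. On the contact plane the norm
has zero derivative, so the Cauchy-Riemann condition persists. -/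
theorem holomorphic_odd (hu : IsContactHolomorphic u) :
    HolomorphicOffZero fun y => (‖y‖ : ℂ) * ((u y - u (-y)) / 2) := by
  have he : (fun y => (u y - u (-y)) / 2) = fun z => (u z + (-1) * u (-z)) / 2 := by
    ext z; rw [neg_one_mul, sub_eq_add_neg]
  have hdw : ∀ y ≠ 0, DifferentiableAt ℝ (fun y => (u y - u (-y)) / 2) y := fun y hy => by
    rw [he]; exact (hu.hasFDerivAt_part (-1) hy).differentiableAt
  have hdn : ∀ y : R4, y ≠ 0 → DifferentiableAt ℝ (fun z : R4 => ‖z‖) y := fun y hy =>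
    (contDiffAt_norm ℝ hy (n := 1)).differentiableAt (by simp)
  have hW : (fun y => (‖y‖ : ℂ) * ((u y - u (-y)) / 2)) =
      fun y => ‖y‖ • ((u y - u (-y)) / 2) := by
    ext y; rw [Complex.real_smul]
  rw [hW]
  have hfd : ∀ y ≠ 0, ∀ v, fderiv ℝ (fun y => ‖y‖ • ((u y - u (-y)) / 2)) y v =
      ‖y‖ * fderiv ℝ (fun y => (u y - u (-y)) / 2) y v +
        fderiv ℝ (fun z : R4 => ‖z‖) y v * ((u y - u (-y)) / 2) := by
    intro y hy v
    have h := (hdn y hy).hasFDerivAt.smul (hdw y hy).hasFDerivAt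
    have h' : HasFDerivAt (fun y => ‖y‖ • ((u y - u (-y)) / 2)) _ y := h
    rw [h'.fderiv]
    simp
  refine ⟨fun y hy => (hdn y hy).smul (hdw y hy), fun y hy => map_quatI_of_frame hy ?_ ?_⟩
  · have hexp : HasDerivAt (fun t : ℝ => Complex.exp (t * Complex.I) * ((u y - u (-y)) / 2))
        (Complex.I * ((u y - u (-y)) / 2)) 0 := by
      have h1 : HasDerivAt (fun t : ℝ => (t : ℂ) * Complex.I) Complex.I 0 := by
        simpa using (Complex.ofRealCLM.hasDerivAt (x := (0 : ℝ))).mul_const Complex.I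
      simpa using h1.cexp.mul_const ((u y - u (-y)) / 2)
    rw [hfd y hy, hfd y hy, fderiv_norm_quat isOrthComplexStructure_quatI hy,
      fderiv_quat_of_orbit isOrthComplexStructure_quatI (hdw y hy) hexp (hu.odd_orbit hy),
      (hdn y hy).fderiv_norm_self, he, hu.fderiv_part_self (-1) hy]
    push_cast
    ring
  · rw [hfd y hy, hfd y hy, fderiv_norm_quat isOrthComplexStructure_quatJ hy,
      fderiv_norm_quat isOrthComplexStructure_quatK hy, he, hu.fderiv_part_quatK (-1) hy]
    push_cast
    ring

theorem ofC2_eq_zero_of {z w : ℂ} (h : ¬(z ≠ 0 ∨ w ≠ 0)) : ofC2 z w = 0 := by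
  obtain ⟨rfl, rfl⟩ : z = 0 ∧ w = 0 := by tauto
  ext i; fin_cases i <;> simp [ofC2]

/-- On the unit sphere such a function is the sum of a constant and a complex linear function. -/
theorem eq_affine (hu : IsContactHolomorphic u) :
    ∃ c α β : ℂ, ∀ z w : ℂ, ‖ofC2 z w‖ = 1 → u (ofC2 z w) = c + z * α + w * β := by
  have hom0 : ∀ c : ℂ, c ≠ 0 → ∀ z w,
      (u (ofC2 (c * z) (c * w)) + u (-ofC2 (c * z) (c * w))) / 2 =
        (u (ofC2 z w) + u (-ofC2 z w)) / 2 := by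
    intro c hc z w
    by_cases h : z ≠ 0 ∨ w ≠ 0
    · rw [ofC2_mul, ← smul_neg, hu.homogeneous _ (norm_pos_iff.2 hc),
        hu.homogeneous _ (norm_pos_iff.2 hc), hu.even_orbit (ofC2_ne_zero h)]
    · have h1 : z = 0 ∧ w = 0 := by tauto
      rw [h1.1, h1.2, mul_zero]
  have hom1 : ∀ c : ℂ, c ≠ 0 → ∀ z w, (‖ofC2 (c * z) (c * w)‖ : ℂ) *
      ((u (ofC2 (c * z) (c * w)) - u (-ofC2 (c * z) (c * w))) / 2) =
        c * (‖ofC2 z w‖ * ((u (ofC2 z w) - u (-ofC2 z w)) / 2)) := by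
    intro c hc z w
    by_cases h : z ≠ 0 ∨ w ≠ 0
    · rw [ofC2_mul, ← smul_neg, hu.homogeneous _ (norm_pos_iff.2 hc),
        hu.homogeneous _ (norm_pos_iff.2 hc), hu.odd_orbit (ofC2_ne_zero h), norm_smul,
        norm_rotFlow isOrthComplexStructure_quatI, norm_norm]
      -- The modulus of `c` comes from the norm factor and its phase from the orbit.
      conv_rhs => rw [← Complex.norm_mul_exp_arg_mul_I c]
      push_cast
      ring
    · have h1 : z = 0 ∧ w = 0 := by tauto
      have h2 := ofC2_eq_zero_of h
      rw [h1.1, h1.2, mul_zero]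
      rw [h1.1, h1.2] at h2
      simp [h2]
  let U : R4 → ℂ := fun y => (‖y‖ : ℂ) * ((u y - u (-y)) / 2)
  refine ⟨(u (ofC2 0 1) + u (-ofC2 0 1)) / 2, U (ofC2 1 0), U (ofC2 0 1), fun z w hn => ?_⟩
  have hne : ofC2 z w ≠ 0 := norm_ne_zero_iff.1 (by rw [hn]; exact one_ne_zero)
  have hzw : z ≠ 0 ∨ w ≠ 0 := by
    by_contra h
    exact hne (ofC2_eq_zero_of h)
  have e0 := hu.holomorphic_even.eq_const hom0 hne
  have e1 : U (ofC2 z w) = _ := hu.holomorphic_odd.eq_linear hom1 hzw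
  have e2 : U (ofC2 z w) = (u (ofC2 z w) - u (-ofC2 z w)) / 2 := by
    simp only [U]
    rw [hn, Complex.ofReal_one, one_mul]
  have e3 : u (ofC2 z w) = (u (ofC2 z w) + u (-ofC2 z w)) / 2 +
    (u (ofC2 z w) - u (-ofC2 z w)) / 2 := by ring
  rw [e3, e0, ← e2, e1, ← add_assoc]

end IsContactHolomorphic

/-! ### The deficit as a sum of two nonnegative energies -/

theorem SmoothOffZero.add {F H : R4 → ℝ} (hF : SmoothOffZero F) (hH : SmoothOffZero H) :
    SmoothOffZero (fun y => F y + H y) := fun y hy => (hF y hy).add (hH y hy)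

theorem SmoothOffZero.sub {F H : R4 → ℝ} (hF : SmoothOffZero F) (hH : SmoothOffZero H) :
    SmoothOffZero (fun y => F y - H y) := fun y hy => (hF y hy).sub (hH y hy)

theorem SmoothOffZero.pow {F : R4 → ℝ} (hF : SmoothOffZero F) (n : ℕ) :
    SmoothOffZero (fun y => F y ^ n) := fun y hy => (hF y hy).pow n

theorem inner_gradS3_gradS3 {f h : S3 → ℝ} (hf : SmoothS3 f) (hh : SmoothS3 h) (x : S3) :
    inner ℝ (gradS3 f x) (gradS3 h x) =
      rotDeriv quatI (radialExt f) x * rotDeriv quatI (radialExt h) x +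
      rotDeriv quatJ (radialExt f) x * rotDeriv quatJ (radialExt h) x +
      rotDeriv quatK (radialExt f) x * rotDeriv quatK (radialExt h) x := by
  have h1 := norm_sq_mul_inner (x : R4) (gradS3 f x) (gradS3 h x)
  rw [norm_S3, inner_gradS3_self, inner_gradS3 hf x (quatI x), inner_gradS3 hf x (quatJ x),
    inner_gradS3 hf x (quatK x), inner_gradS3 hh x (quatI x),
    inner_gradS3 hh x (quatJ x), inner_gradS3 hh x (quatK x)] at h1
  simpa [rotDeriv] using h1

theorem norm_sq_gradS3 {f : S3 → ℝ} (hf : SmoothS3 f) (x : S3) :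
    ‖gradS3 f x‖ ^ 2 = rotDeriv quatI (radialExt f) x ^ 2 +
      rotDeriv quatJ (radialExt f) x ^ 2 + rotDeriv quatK (radialExt f) x ^ 2 := by
  rw [← real_inner_self_eq_norm_sq, inner_gradS3_gradS3 hf hf]; ring

theorem kahlerForm_gradS3 {f h : S3 → ℝ} (hf : SmoothS3 f) (hh : SmoothS3 h) (x : S3) :
    kahlerForm (inclC3 (gradS3 f x)) (inclC3 (gradS3 h x)) =
      rotDeriv quatJ (radialExt f) x * rotDeriv quatK (radialExt h) x -
      rotDeriv quatK (radialExt f) x * rotDeriv quatJ (radialExt h) x := by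
  have h1 := norm_sq_mul_kahlerForm (x : R4) (gradS3 f x) (gradS3 h x)
  rw [norm_S3, inner_gradS3_self, inner_gradS3_self, inner_gradS3 hf x (quatJ x),
    inner_gradS3 hf x (quatK x), inner_gradS3 hh x (quatJ x),
    inner_gradS3 hh x (quatK x)] at h1
  simpa [rotDeriv] using h1

theorem gradNorm_sq (f : S3 → ℝ) : gradNorm f ^ 2 = ∫ x, ‖gradS3 f x‖ ^ 2 ∂volS3 :=
  Real.sq_sqrt (integral_nonneg fun _ => sq_nonneg _)

/-- The density of the quadratic form of `T(T - 1)` on `f - ih`, `T = -i d/dt` along the Hopf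
circles. -/
noncomputable def hopfEnergy (F H : R4 → ℝ) (y : R4) : ℝ :=
  rotDeriv quatI F y ^ 2 + rotDeriv quatI H y ^ 2 +
    (F y * rotDeriv quatI H y - H y * rotDeriv quatI F y)

/-- The squared norm of the antiholomorphic part of the differential of `f - ih` on the contact
planes. -/
noncomputable def contactEnergy (F H : R4 → ℝ) (y : R4) : ℝ :=
  (rotDeriv quatJ F y + rotDeriv quatK H y) ^ 2 + (rotDeriv quatK F y - rotDeriv quatJ H y) ^ 2

theorem smoothOffZero_hopfEnergy {F H : R4 → ℝ} (hF : SmoothOffZero F) (hH : SmoothOffZero H) :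
    SmoothOffZero (hopfEnergy F H) :=
  (((hF.rotDeriv _).pow 2).add ((hH.rotDeriv _).pow 2)).add
    ((hF.mul (hH.rotDeriv _)).sub (hH.mul (hF.rotDeriv _)))

theorem smoothOffZero_contactEnergy {F H : R4 → ℝ} (hF : SmoothOffZero F)
    (hH : SmoothOffZero H) : SmoothOffZero (contactEnergy F H) :=
  (((hF.rotDeriv _).add (hH.rotDeriv _)).pow 2).add (((hF.rotDeriv _).sub (hH.rotDeriv _)).pow 2)

theorem integrable_norm_sq_gradS3 {f : S3 → ℝ} (hf : SmoothS3 f) :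
    Integrable (fun x => ‖gradS3 f x‖ ^ 2) volS3 := by
  have hF := smoothOffZero_radialExt hf
  simp only [norm_sq_gradS3 hf]
  exact ((((hF.rotDeriv quatI).pow 2).add ((hF.rotDeriv quatJ).pow 2)).add
    ((hF.rotDeriv quatK).pow 2)).integrable

/-- The deficit in the Cauchy-Riemann inequality as a sum of two energies. -/
theorem deficit_eq {f h : S3 → ℝ} (hf : SmoothS3 f) (hh : SmoothS3 h) :
    gradNorm f ^ 2 + gradNorm h ^ 2 + 3 * kahlerIntegral f h =
      ∫ x : S3, contactEnergy (radialExt f) (radialExt h) x ∂volS3 +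
      ∫ x : S3, hopfEnergy (radialExt f) (radialExt h) x ∂volS3 := by
  set F := radialExt f with hFdef
  set H := radialExt h with hHdef
  have hF : SmoothOffZero F := smoothOffZero_radialExt hf
  have hH : SmoothOffZero H := smoothOffZero_radialExt hh
  have hω : SmoothOffZero fun y => rotDeriv quatJ F y * rotDeriv quatK H y -
      rotDeriv quatK F y * rotDeriv quatJ H y :=
    ((hF.rotDeriv _).mul (hH.rotDeriv _)).sub ((hF.rotDeriv _).mul (hH.rotDeriv _))
  have hK : kahlerIntegral f h = ∫ x : S3, (rotDeriv quatJ F x * rotDeriv quatK H x -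
      rotDeriv quatK F x * rotDeriv quatJ H x) ∂volS3 := by
    rw [kahlerIntegral]; simp only [kahlerForm_gradS3 hf hh, hFdef, hHdef]
  -- Half of `2 ∫ F·IH` is integrated by parts along I to make the expression antisymmetric in `F`
  -- and `H`.
  have hK2 : kahlerIntegral f h =
      ∫ x : S3, (F x * rotDeriv quatI H x - H x * rotDeriv quatI F x) ∂volS3 := by
    have h1 := integral_mul_rotDeriv isOrthComplexStructure_quatI hF hH
    rw [hK, integral_bracket hF hH,
      integral_sub (hF.mul (hH.rotDeriv _)).integrable (hH.mul (hF.rotDeriv _)).integrable]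
    simp only [mul_comm (H _)]
    linarith
  -- Two copies go to the contact energy as the Jacobian `JF·KH - KF·JH`, and one to the Hopf energy
  -- in the form `hK2`.
  have hsplit : gradNorm f ^ 2 + gradNorm h ^ 2 + 3 * kahlerIntegral f h =
      gradNorm f ^ 2 + gradNorm h ^ 2 + 2 * kahlerIntegral f h + kahlerIntegral f h := by ring
  rw [hsplit]
  nth_rw 2 [hK2]
  have i1 : Integrable (fun x : S3 => 2 * (rotDeriv quatJ F x * rotDeriv quatK H x -
      rotDeriv quatK F x * rotDeriv quatJ H x)) volS3 := hω.integrable.const_mul 2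
  have i2 : Integrable (fun x => ‖gradS3 f x‖ ^ 2 + ‖gradS3 h x‖ ^ 2) volS3 :=
    (integrable_norm_sq_gradS3 hf).add (integrable_norm_sq_gradS3 hh)
  have i3 : Integrable (fun x => ‖gradS3 f x‖ ^ 2 + ‖gradS3 h x‖ ^ 2 +
      2 * (rotDeriv quatJ F x * rotDeriv quatK H x -
        rotDeriv quatK F x * rotDeriv quatJ H x)) volS3 := i2.add i1
  rw [hK, gradNorm_sq, gradNorm_sq, ← integral_const_mul,
    ← integral_add (integrable_norm_sq_gradS3 hf) (integrable_norm_sq_gradS3 hh),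
    ← integral_add i2 i1,
    ← integral_add i3 ((hF.mul (hH.rotDeriv _)).sub (hH.mul (hF.rotDeriv _))).integrable,
    ← integral_add (smoothOffZero_contactEnergy hF hH).integrable
      (smoothOffZero_hopfEnergy hF hH).integrable]
  congr 1
  ext x
  rw [norm_sq_gradS3 hf, norm_sq_gradS3 hh, contactEnergy, hopfEnergy]
  ring

section Orbit

variable {F H : R4 → ℝ}

theorem hasDerivAt_complex_orbit (hF : SmoothOffZero F) (hH : SmoothOffZero H) {y : R4}
    (hy : y ≠ 0) (t : ℝ) :
    HasDerivAt (fun s => (F (rotFlow quatI s y) : ℂ) - Complex.I * H (rotFlow quatI s y))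
      ((rotDeriv quatI F (rotFlow quatI t y) : ℂ) -
        Complex.I * rotDeriv quatI H (rotFlow quatI t y)) t := by
  have hI := isOrthComplexStructure_quatI
  exact (hasDerivAt_comp_rotFlow hI hF hy t).ofReal_comp.sub
    ((hasDerivAt_comp_rotFlow hI hH hy t).ofReal_comp.const_mul Complex.I)

theorem hopfEnergy_eq (F H : R4 → ℝ) (y : R4) :
    hopfEnergy F H y = ‖((rotDeriv quatI F y : ℂ) - Complex.I * rotDeriv quatI H y) -
      Complex.I / 2 * ((F y : ℂ) - Complex.I * H y)‖ ^ 2 -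
      1 / 4 * ‖(F y : ℂ) - Complex.I * H y‖ ^ 2 := by
  have e : ((rotDeriv quatI F y : ℂ) - Complex.I * rotDeriv quatI H y) -
      Complex.I / 2 * ((F y : ℂ) - Complex.I * H y) =
      ⟨rotDeriv quatI F y - H y / 2, -rotDeriv quatI H y - F y / 2⟩ := by
    apply Complex.ext <;> simp <;> ring
  have e' : (F y : ℂ) - Complex.I * H y = ⟨F y, -H y⟩ := by
    apply Complex.ext <;> simp
  rw [e, e', Complex.sq_norm, Complex.sq_norm, Complex.normSq_mk, Complex.normSq_mk, hopfEnergy]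
  ring

theorem continuous_complex_orbit_deriv (hF : SmoothOffZero F) (hH : SmoothOffZero H) (x : S3) :
    Continuous fun t => (rotDeriv quatI F (rotFlow quatI t x) : ℂ) -
      Complex.I * rotDeriv quatI H (rotFlow quatI t x) := by
  have hI := isOrthComplexStructure_quatI
  have h1 := continuous_orbit hI (hF.rotDeriv quatI).continuousAt x
  have h2 := continuous_orbit hI (hH.rotDeriv quatI).continuousAt x
  fun_prop

theorem hopfEnergy_orbit_nonneg (hF : SmoothOffZero F) (hH : SmoothOffZero H) (x : S3) :
    0 ≤ ∫ t in (0 : ℝ)..2 * Real.pi, hopfEnergy F H (rotFlow quatI t x) := by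
  simp only [hopfEnergy_eq]
  exact shifted_energy_nonneg (hasDerivAt_complex_orbit hF hH (S3_ne_zero x))
    (continuous_complex_orbit_deriv hF hH x) (by rw [rotFlow_two_pi, rotFlow_zero])

theorem integral_hopfEnergy (hF : SmoothOffZero F) (hH : SmoothOffZero H) :
    ∫ x : S3, (∫ t in (0 : ℝ)..2 * Real.pi, hopfEnergy F H (rotFlow quatI t x)) ∂volS3 =
      2 * Real.pi * ∫ x : S3, hopfEnergy F H x ∂volS3 :=
  integral_orbit isOrthComplexStructure_quatI (smoothOffZero_hopfEnergy hF hH).continuousAt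

theorem integral_hopfEnergy_nonneg (hF : SmoothOffZero F) (hH : SmoothOffZero H) :
    0 ≤ ∫ x : S3, hopfEnergy F H x ∂volS3 := by
  have h : 0 ≤ 2 * Real.pi * ∫ x : S3, hopfEnergy F H x ∂volS3 := by
    rw [← integral_hopfEnergy hF hH]
    exact integral_nonneg (hopfEnergy_orbit_nonneg hF hH)
  exact nonneg_of_mul_nonneg_right h (by positivity)

theorem contactEnergy_nonneg (F H : R4 → ℝ) (y : R4) : 0 ≤ contactEnergy F H y := by
  unfold contactEnergy; positivity

/-- The orbit integrals are nonnegative and continuous in the base point, so a zero total forces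
each of them to vanish. -/
theorem hopfEnergy_orbit_eq_zero (hF : SmoothOffZero F) (hH : SmoothOffZero H)
    (h0 : ∫ x : S3, hopfEnergy F H x ∂volS3 = 0) (x : S3) :
    ∫ t in (0 : ℝ)..2 * Real.pi, hopfEnergy F H (rotFlow quatI t x) = 0 := by
  refine eq_zero_of_integral_S3_eq_zero ?_ (hopfEnergy_orbit_nonneg hF hH)
    (by rw [integral_hopfEnergy hF hH, h0, mul_zero]) x
  have hc : Continuous fun p : S3 × ℝ => hopfEnergy F H (rotFlow quatI p.2 p.1) := by
    rw [continuous_iff_continuousAt]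
    intro p
    refine ContinuousAt.comp (g := hopfEnergy F H) (f := fun p : S3 × ℝ => rotFlow quatI p.2 p.1)
      ((smoothOffZero_hopfEnergy hF hH).continuousAt _
        (rotFlow_ne_zero isOrthComplexStructure_quatI _ (S3_ne_zero p.1))) ?_
    unfold rotFlow
    fun_prop
  exact intervalIntegral.continuous_parametric_intervalIntegral_of_continuous' hc _ _

theorem orbit_eq_of_hopfEnergy_eq_zero (hF : SmoothOffZero F) (hH : SmoothOffZero H) (x : S3)
    (h0 : ∫ t in (0 : ℝ)..2 * Real.pi, hopfEnergy F H (rotFlow quatI t x) = 0) (t : ℝ) :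
    (F (rotFlow quatI t x) : ℂ) - Complex.I * H (rotFlow quatI t x) =
      (((F x : ℂ) - Complex.I * H x) + ((F (-x : R4) : ℂ) - Complex.I * H (-x : R4))) / 2 +
      Complex.exp (t * Complex.I) *
        ((((F x : ℂ) - Complex.I * H x) - ((F (-x : R4) : ℂ) - Complex.I * H (-x : R4))) / 2) := by
  simp only [hopfEnergy_eq] at h0
  obtain ⟨a, b, hab⟩ := eq_of_shifted_energy_eq_zero
    (hasDerivAt_complex_orbit hF hH (S3_ne_zero x))
    (continuous_complex_orbit_deriv hF hH x) (by rw [rotFlow_two_pi, rotFlow_zero]) h0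
  have hpi := Real.pi_pos
  -- The values at `t = 0` and `t = π`, that is at `x` and `-x`, determine `a` and `b`.
  have h1 := hab 0 ⟨le_rfl, by positivity⟩
  have h2 := hab Real.pi ⟨hpi.le, by linarith⟩
  rw [rotFlow_zero] at h1
  rw [rotFlow_pi, Complex.exp_pi_mul_I] at h2
  rw [Complex.ofReal_zero, zero_mul, Complex.exp_zero] at h1
  rw [h1, h2]
  -- The formula is known on one period only; a general `t` is reduced modulo `2π`.
  have h3 := hab (toIcoMod Real.two_pi_pos 0 t) (by
    have := toIcoMod_mem_Ico Real.two_pi_pos 0 t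
    rw [zero_add] at this
    exact Set.Ico_subset_Icc_self this)
  have hmod : toIcoMod Real.two_pi_pos 0 t = t - toIcoDiv Real.two_pi_pos 0 t * (2 * Real.pi) := by
    rw [toIcoMod, zsmul_eq_mul]
  have hrot : rotFlow quatI (toIcoMod Real.two_pi_pos 0 t) (x : R4) = rotFlow quatI t x := by
    rw [hmod, rotFlow, Real.cos_sub_int_mul_two_pi, Real.sin_sub_int_mul_two_pi, rotFlow]
  have hexp : Complex.exp ((toIcoMod Real.two_pi_pos 0 t : ℝ) * Complex.I) =
      Complex.exp (t * Complex.I) := by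
    rw [Complex.exp_mul_I, Complex.exp_mul_I, ← Complex.ofReal_cos, ← Complex.ofReal_sin,
      ← Complex.ofReal_cos, ← Complex.ofReal_sin, hmod, Real.cos_sub_int_mul_two_pi,
      Real.sin_sub_int_mul_two_pi]
  rw [hrot, hexp] at h3
  rw [h3]
  ring

end Orbit

theorem deficit_nonneg {f h : S3 → ℝ} (hf : SmoothS3 f) (hh : SmoothS3 h) :
    0 ≤ gradNorm f ^ 2 + gradNorm h ^ 2 + 3 * kahlerIntegral f h := by
  rw [deficit_eq hf hh]
  exact add_nonneg (integral_nonneg fun x => contactEnergy_nonneg _ _ _)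
    (integral_hopfEnergy_nonneg (smoothOffZero_radialExt hf) (smoothOffZero_radialExt hh))

theorem isContactHolomorphic_of_deficit_eq_zero {f h : S3 → ℝ} (hf : SmoothS3 f)
    (hh : SmoothS3 h) (h0 : gradNorm f ^ 2 + gradNorm h ^ 2 + 3 * kahlerIntegral f h = 0) :
    IsContactHolomorphic fun y => (radialExt f y : ℂ) - Complex.I * radialExt h y := by
  set F := radialExt f with hFdef
  set H := radialExt h with hHdef
  have hF : SmoothOffZero F := smoothOffZero_radialExt hf
  have hH : SmoothOffZero H := smoothOffZero_radialExt hh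
  have hFh : ∀ c : ℝ, 0 < c → ∀ y, F (c • y) = F y := fun c hc y => radialExt_smul f hc y
  have hHh : ∀ c : ℝ, 0 < c → ∀ y, H (c • y) = H y := fun c hc y => radialExt_smul h hc y
  rw [deficit_eq hf hh] at h0
  have hn1 : 0 ≤ ∫ x : S3, contactEnergy F H x ∂volS3 :=
    integral_nonneg fun x => contactEnergy_nonneg _ _ _
  have hn2 := integral_hopfEnergy_nonneg hF hH
  have hc : ∫ x : S3, contactEnergy F H x ∂volS3 = 0 := by linarith
  have ho : ∫ x : S3, hopfEnergy F H x ∂volS3 = 0 := by linarith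
  have hcx : ∀ x : S3, contactEnergy F H x = 0 :=
    eq_zero_of_integral_S3_eq_zero
      (continuous_restrict_S3 (smoothOffZero_contactEnergy hF hH).continuousAt)
      (fun x => contactEnergy_nonneg _ _ _) hc
  have hder : ∀ y ≠ 0, HasFDerivAt (fun y => (F y : ℂ) - Complex.I * H y)
      (Complex.ofRealCLM.comp (fderiv ℝ F y) -
        Complex.I • Complex.ofRealCLM.comp (fderiv ℝ H y)) y := fun y hy =>
    (Complex.ofRealCLM.hasFDerivAt.comp y (hF.differentiableAt hy).hasFDerivAt).sub
      ((Complex.ofRealCLM.hasFDerivAt.comp y (hH.differentiableAt hy).hasFDerivAt).const_smul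
        Complex.I)
  -- The vanishing energies give information on the sphere; homogeneity carries it to all nonzero
  -- points.
  have hpolar : ∀ y : R4, y ≠ 0 → ∃ (c : ℝ) (x : S3), 0 < c ∧ y = c • (x : R4) := by
    intro y hy
    have hn : ‖y‖ ≠ 0 := norm_ne_zero_iff.2 hy
    exact ⟨‖y‖, radialProj y, norm_pos_iff.2 hy, by rw [coe_radialProj hy, smul_smul,
      mul_inv_cancel₀ hn, one_smul]⟩
  refine ⟨fun y hy => (hder y hy).differentiableAt, fun c hc y => by rw [hFh c hc, hHh c hc],
    fun y hy => ?_, fun y hy t => ?_⟩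
  · obtain ⟨c, x, hcpos, rfl⟩ := hpolar y hy
    have h1 := hcx x
    rw [contactEnergy, add_eq_zero_iff_of_nonneg (sq_nonneg _) (sq_nonneg _), sq_eq_zero_iff,
      sq_eq_zero_iff] at h1
    have eF := smul_fderiv_smul_of_homogeneous hFh hcpos (hF.differentiableAt (S3_ne_zero x))
    have eH := smul_fderiv_smul_of_homogeneous hHh hcpos (hH.differentiableAt (S3_ne_zero x))
    have e1 : fderiv ℝ F (c • (x : R4)) (quatJ (c • (x : R4))) = rotDeriv quatJ F x := by
      rw [rotDeriv, ← eF, map_smul, map_smul]; rfl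
    have e2 : fderiv ℝ F (c • (x : R4)) (quatK (c • (x : R4))) = rotDeriv quatK F x := by
      rw [rotDeriv, ← eF, map_smul, map_smul]; rfl
    have e3 : fderiv ℝ H (c • (x : R4)) (quatJ (c • (x : R4))) = rotDeriv quatJ H x := by
      rw [rotDeriv, ← eH, map_smul, map_smul]; rfl
    have e4 : fderiv ℝ H (c • (x : R4)) (quatK (c • (x : R4))) = rotDeriv quatK H x := by
      rw [rotDeriv, ← eH, map_smul, map_smul]; rfl
    rw [(hder _ hy).fderiv]
    simp only [sub_apply, smul_apply, ContinuousLinearMap.comp_apply, e1, e2, e3, e4,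
      Complex.ofRealCLM_apply, smul_eq_mul]
    have g1 : rotDeriv quatJ F x = -rotDeriv quatK H x := by linarith [h1.1]
    have g2 : rotDeriv quatK F x = rotDeriv quatJ H x := by linarith [h1.2]
    rw [g1, g2]
    push_cast
    linear_combination (rotDeriv quatJ H x : ℂ) * Complex.I_mul_I
  · obtain ⟨c, x, hcpos, rfl⟩ := hpolar y hy
    have hr : rotFlow quatI t (c • (x : R4)) = c • rotFlow quatI t x := by
      simp only [rotFlow, map_smul, smul_add, smul_comm c]
    rw [hr, ← smul_neg]
    simp only [hFh c hcpos, hHh c hcpos]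
    exact orbit_eq_of_hopfEnergy_eq_zero hF hH x (hopfEnergy_orbit_eq_zero hF hH ho x) t

/-! ### Affine functions: gradients, eigenvalue and vanishing deficit -/

theorem smoothS3_affine (a : ℝ) (m : R4) : SmoothS3 fun x => a + inner ℝ m (x : R4) := by
  have h1 : ContDiff ℝ ∞ fun y : R4 => a + inner ℝ m y :=
    contDiff_const.add (innerSL ℝ m).contDiff
  exact h1.contMDiff.comp (contMDiff_coe_sphere (n := 3) (E := R4))

theorem inner_coe_inclDeriv (x : S3) (w : TangentSpace (𝓡 3) x) :
    inner ℝ (x : R4) (inclDeriv x w) = 0 := by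
  have h : inclDeriv x w ∈ (inclDeriv x).range := ⟨w, rfl⟩
  rw [range_inclDeriv] at h
  exact Submodule.mem_orthogonal_singleton_iff_inner_right.1 h

theorem gradS3_affine (a : ℝ) (m : R4) (x : S3) :
    gradS3 (fun x => a + inner ℝ m (x : R4)) x = m - inner ℝ m (x : R4) • (x : R4) := by
  apply gradS3_eq_of_isGradS3
  refine ⟨?_, fun w => ?_⟩
  · rw [inner_sub_left, inner_smul_left, real_inner_self_eq_norm_sq, norm_S3]
    simp
  · have hd : HasFDerivAt (fun y : R4 => a + inner ℝ m y) (innerSL ℝ m) (x : R4) :=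
      ((innerSL ℝ m).hasFDerivAt).const_add a
    rw [diffS3_eq_of_comp (F := fun y : R4 => a + inner ℝ m y) (fun _ => rfl) x
      hd.differentiableAt, hd.fderiv, inner_sub_left, inner_smul_left, inner_coe_inclDeriv]
    simp

theorem rotDeriv_radialExt_affine {A : R4 →L[ℝ] R4} (hA : IsOrthComplexStructure A) (a : ℝ)
    (m : R4) (x : S3) :
    rotDeriv A (radialExt fun x => a + inner ℝ m (x : R4)) x = inner ℝ m (A x) := by
  rw [rotDeriv, ← inner_gradS3 (smoothS3_affine a m), gradS3_affine, inner_sub_left,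
    inner_smul_left, hA.inner_apply_self]
  simp

theorem gradS3_const_mul {h : S3 → ℝ} (hh : SmoothS3 h) (c : ℝ) (x : S3) :
    gradS3 (fun x => c * h x) x = c • gradS3 h x := by
  apply gradS3_eq_of_isGradS3
  obtain ⟨h1, h2⟩ := isGradS3_gradS3 h x
  refine ⟨by rw [inner_smul_left, h1, mul_zero], fun w => ?_⟩
  have hd := differentiableAt_radialExt hh (S3_ne_zero x)
  rw [inner_smul_left, h2, diffS3_eq_of_comp (radialExt_coe h) x hd,
    diffS3_eq_of_comp (F := fun y => c * radialExt h y)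
      (fun x => by rw [radialExt_coe]) x (hd.const_mul c), fderiv_const_mul hd]
  simp

theorem gradNorm_nonneg (f : S3 → ℝ) : 0 ≤ gradNorm f := Real.sqrt_nonneg _

theorem gradNorm_of_gradS3_eq {h k : S3 → ℝ} {c : ℝ} (hc : 0 ≤ c)
    (hk : ∀ x, gradS3 h x = c • gradS3 k x) : gradNorm h = c * gradNorm k := by
  rw [gradNorm, gradNorm]
  simp only [hk, norm_smul, mul_pow, Real.norm_eq_abs, sq_abs]
  rw [integral_const_mul, Real.sqrt_mul (sq_nonneg c), Real.sqrt_sq hc]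

theorem kahlerIntegral_of_gradS3_eq {f f' h k : S3 → ℝ} {c : ℝ}
    (hf : ∀ x, gradS3 f x = gradS3 f' x) (hk : ∀ x, gradS3 h x = c • gradS3 k x) :
    kahlerIntegral f h = c * kahlerIntegral f' k := by
  rw [kahlerIntegral, kahlerIntegral, ← integral_const_mul]
  simp only [hf, hk, kahlerForm_smul_right]

theorem gradS3_const (a : ℝ) (x : S3) : gradS3 (fun _ => a) x = 0 := by
  simpa using gradS3_affine a 0 x

theorem gradNorm_const (a : ℝ) : gradNorm (fun _ => a) = 0 := by
  simp [gradNorm, gradS3_const]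

theorem kahlerIntegral_const_left (a : ℝ) (h : S3 → ℝ) : kahlerIntegral (fun _ => a) h = 0 := by
  simp [kahlerIntegral, gradS3_const, kahlerForm, inclC3]

theorem kahlerIntegral_const_right (f : S3 → ℝ) (b : ℝ) : kahlerIntegral f (fun _ => b) = 0 := by
  simp [kahlerIntegral, gradS3_const, kahlerForm, inclC3]

theorem rotDeriv_inner (A : R4 →L[ℝ] R4) (m y : R4) :
    rotDeriv A (fun z => inner ℝ m z) y = inner ℝ m (A y) := by
  have hd : HasFDerivAt (fun y : R4 => inner ℝ m y) (innerSL ℝ m) y := (innerSL ℝ m).hasFDerivAt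
  rw [rotDeriv, hd.fderiv]
  rfl

theorem smoothOffZero_inner (m : R4) : SmoothOffZero fun y => inner ℝ m y := fun y _ => by
  have h1 : ContDiff ℝ ∞ fun y : R4 => inner ℝ m y := (innerSL ℝ m).contDiff
  exact h1.contDiffAt

/-- Since `A² = -1`, the second derivative of a linear function along `A` is its negative. Adding
the three fields I, J, K gives the eigenvalue 3. -/
theorem integral_rotDeriv_mul_inner {A : R4 →L[ℝ] R4} (hA : IsOrthComplexStructure A)
    {G : R4 → ℝ} (hG : SmoothOffZero G) (m : R4) :
    ∫ x : S3, rotDeriv A G x * inner ℝ m (A x) ∂volS3 =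
      ∫ x : S3, G x * inner ℝ m (x : R4) ∂volS3 := by
  have h1 := integral_mul_rotDeriv hA hG ((smoothOffZero_inner m).rotDeriv A)
  have h2 : rotDeriv A (fun z => inner ℝ m z) = fun y => inner ℝ (A.adjoint m) y := by
    ext y; rw [rotDeriv_inner, ContinuousLinearMap.adjoint_inner_left]
  have h3 : ∀ y, rotDeriv A (rotDeriv A fun z => inner ℝ m z) y = -inner ℝ m y := by
    intro y
    rw [h2, rotDeriv_inner, ContinuousLinearMap.adjoint_inner_left, hA.apply_apply,
      inner_neg_right]
  simp only [h3, rotDeriv_inner, mul_neg, integral_neg, neg_neg] at h1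
  exact h1

/-- Linear functions are eigenfunctions of the Laplacian. -/
theorem linear_mem_eigenspaceS3 (m : R4) :
    (fun x : S3 => inner ℝ m (x : R4)) ∈ eigenspaceS3 3 := by
  have he : (fun x : S3 => inner ℝ m (x : R4)) = fun x : S3 => 0 + inner ℝ m (x : R4) := by
    ext x; rw [zero_add]
  have hs := smoothS3_affine 0 m
  rw [← he] at hs
  refine ⟨hs, fun g hg => ?_⟩
  have hr : ∀ {A : R4 →L[ℝ] R4}, IsOrthComplexStructure A → ∀ x : S3,
      rotDeriv A (radialExt fun x : S3 => inner ℝ m (x : R4)) x = inner ℝ m (A x) := by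
    intro A hA x; rw [he, rotDeriv_radialExt_affine hA]
  have hI := isOrthComplexStructure_quatI
  have hJ := isOrthComplexStructure_quatJ
  have hK := isOrthComplexStructure_quatK
  have hG := smoothOffZero_radialExt hg
  have hi : ∀ A : R4 →L[ℝ] R4,
      Integrable (fun x : S3 => rotDeriv A (radialExt g) x * inner ℝ m (A x)) volS3 := by
    intro A
    have := (hG.rotDeriv A).mul ((smoothOffZero_inner m).rotDeriv A)
    simp only [rotDeriv_inner] at this
    exact this.integrable
  have e : ∀ x : S3, inner ℝ (gradS3 (fun x : S3 => inner ℝ m (x : R4)) x) (gradS3 g x) =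
      rotDeriv quatI (radialExt g) x * inner ℝ m (quatI x) +
      rotDeriv quatJ (radialExt g) x * inner ℝ m (quatJ x) +
      rotDeriv quatK (radialExt g) x * inner ℝ m (quatK x) := by
    intro x
    rw [inner_gradS3_gradS3 hs hg, hr hI, hr hJ, hr hK]
    ring
  have hIJ : Integrable (fun x : S3 => rotDeriv quatI (radialExt g) x * inner ℝ m (quatI x) +
      rotDeriv quatJ (radialExt g) x * inner ℝ m (quatJ x)) volS3 := (hi quatI).add (hi quatJ)
  simp only [e]
  rw [integral_add hIJ (hi quatK), integral_add (hi quatI) (hi quatJ),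
    integral_rotDeriv_mul_inner hI hG, integral_rotDeriv_mul_inner hJ hG,
    integral_rotDeriv_mul_inner hK hG]
  simp only [radialExt_coe, mul_comm (g _)]
  ring

/-- The eigenvalue equation tested against the constant 1. -/
theorem integral_linear (m : R4) : ∫ x : S3, inner ℝ m (x : R4) ∂volS3 = 0 := by
  have h := (linear_mem_eigenspaceS3 m).2 (fun _ => 1) contMDiff_const
  simpa [gradS3_const] using h

theorem inner_neg_quatI (m y : R4) : inner ℝ (-quatI m) y = inner ℝ m (quatI y) := by
  rw [inner_R4, inner_R4]; simp [quatI_apply]; ring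

/-- Both energy densities vanish pointwise: the corresponding `f - ih` is complex linear. -/
theorem deficit_linear (m : R4) :
    gradNorm (fun x : S3 => 0 + inner ℝ m (x : R4)) ^ 2 +
      gradNorm (fun x : S3 => 0 + inner ℝ (-quatI m) (x : R4)) ^ 2 +
      3 * kahlerIntegral (fun x : S3 => 0 + inner ℝ m (x : R4))
        (fun x : S3 => 0 + inner ℝ (-quatI m) (x : R4)) = 0 := by
  have hI := isOrthComplexStructure_quatI
  have hJ := isOrthComplexStructure_quatJ
  have hK := isOrthComplexStructure_quatK
  rw [deficit_eq (smoothS3_affine 0 m) (smoothS3_affine 0 (-quatI m))]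
  have h1 : ∀ x : S3, contactEnergy (radialExt fun x : S3 => 0 + inner ℝ m (x : R4))
      (radialExt fun x : S3 => 0 + inner ℝ (-quatI m) (x : R4)) x = 0 := by
    intro x
    rw [contactEnergy, rotDeriv_radialExt_affine hJ, rotDeriv_radialExt_affine hK,
      rotDeriv_radialExt_affine hJ, rotDeriv_radialExt_affine hK, inner_neg_quatI,
      inner_neg_quatI, quatI_quatK, quatI_quatJ, inner_neg_right]
    ring
  have h2 : ∀ x : S3, hopfEnergy (radialExt fun x : S3 => 0 + inner ℝ m (x : R4))
      (radialExt fun x : S3 => 0 + inner ℝ (-quatI m) (x : R4)) x = 0 := by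
    intro x
    rw [hopfEnergy, rotDeriv_radialExt_affine hI, rotDeriv_radialExt_affine hI,
      radialExt_coe, radialExt_coe, inner_neg_quatI, inner_neg_quatI, quatI_quatI,
      inner_neg_right]
    ring
  simp only [h1, h2, integral_zero, add_zero]

theorem gradS3_affine_eq (a : ℝ) (c : ℝ) (m : R4) (x : S3) :
    gradS3 (fun x => a + inner ℝ (c • m) (x : R4)) x =
      c • gradS3 (fun x => 0 + inner ℝ m (x : R4)) x := by
  rw [gradS3_affine, gradS3_affine, inner_smul_left, smul_sub, smul_smul]
  rfl

/-! ### Equality cases and the sharp inequality -/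

/-- The pairs with vanishing deficit. -/
theorem deficit_eq_zero_iff {f h : S3 → ℝ} (hf : SmoothS3 f) (hh : SmoothS3 h) :
    gradNorm f ^ 2 + gradNorm h ^ 2 + 3 * kahlerIntegral f h = 0 ↔
      ∃ (a b : ℝ) (m : R4), (∀ x : S3, f x = a + inner ℝ m (x : R4)) ∧
        ∀ x : S3, h x = b + inner ℝ (-quatI m) (x : R4) := by
  constructor
  · intro h0
    obtain ⟨c, α, β, hu⟩ := (isContactHolomorphic_of_deficit_eq_zero hf hh h0).eq_affine
    -- From `f - ih = c + zα + wβ`, `f` is the real part and `h` is minus the imaginary part; `m`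
    -- collects the real coefficients of `Re (zα + wβ)`.
    refine ⟨c.re, -c.im, !₂[α.re, -α.im, β.re, -β.im], ?_⟩
    have key : ∀ x : S3, (f x : ℂ) - Complex.I * h x =
        c + ⟨(x : R4) 0, (x : R4) 1⟩ * α + ⟨(x : R4) 2, (x : R4) 3⟩ * β := by
      intro x
      have := hu ⟨(x : R4) 0, (x : R4) 1⟩ ⟨(x : R4) 2, (x : R4) 3⟩
        (by rw [← eq_ofC2, norm_S3])
      rwa [← eq_ofC2, radialExt_coe, radialExt_coe] at this
    constructor
    · intro x
      have := congrArg Complex.re (key x)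
      simp only [Complex.sub_re, Complex.add_re, Complex.mul_re, Complex.ofReal_re, Complex.I_re,
        Complex.I_im, Complex.ofReal_im] at this
      rw [inner_R4]
      simp
      linarith
    · intro x
      have := congrArg Complex.im (key x)
      simp only [Complex.sub_im, Complex.add_im, Complex.mul_im, Complex.ofReal_re, Complex.I_re,
        Complex.I_im, Complex.ofReal_im] at this
      rw [inner_R4]
      simp [quatI_apply]
      linarith
  · rintro ⟨a, b, m, hfa, hhb⟩
    obtain rfl : f = fun x : S3 => a + inner ℝ m (x : R4) := funext hfa
    obtain rfl : h = fun x : S3 => b + inner ℝ (-quatI m) (x : R4) := funext hhb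
    have e1 := gradS3_affine_eq a 1 m
    have e2 := gradS3_affine_eq b 1 (-quatI m)
    simp only [one_smul] at e1 e2
    have e2' : ∀ x, gradS3 (fun x : S3 => b + inner ℝ (-quatI m) (x : R4)) x =
      (1 : ℝ) • gradS3 (fun x : S3 => 0 + inner ℝ (-quatI m) (x : R4)) x := by simpa using e2
    rw [kahlerIntegral_of_gradS3_eq e1 e2', one_mul, gradNorm, gradNorm]
    simp only [e1, e2]
    exact deficit_linear m

/-- If `n ≠ 0`, the values at the unit vectors along `n` and `-n` differ by `2‖n‖`. -/
theorem eq_zero_of_affine_const {b c : ℝ} {n : R4} (h : ∀ x : S3, b + inner ℝ n (x : R4) = c) :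
    n = 0 := by
  by_contra hn
  have h1 := h (radialProj n)
  have h2 := h (radialProj (-n))
  rw [coe_radialProj hn, inner_smul_right, real_inner_self_eq_norm_sq] at h1
  rw [coe_radialProj (neg_ne_zero.2 hn), inner_smul_right, inner_neg_right,
    real_inner_self_eq_norm_sq, norm_neg] at h2
  have hp : 0 < ‖n‖ := norm_pos_iff.2 hn
  have : 0 < ‖n‖⁻¹ * ‖n‖ ^ 2 := by positivity
  linarith

/-- The pair `(f, 0)` has zero deficit, so the rigidity statement applies; constancy of the second
function forces `m = 0`. -/
theorem eq_const_of_gradNorm_eq_zero {f : S3 → ℝ} (hf : SmoothS3 f) (h0 : gradNorm f = 0) :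
    ∃ a, ∀ x, f x = a := by
  have hd : gradNorm f ^ 2 + gradNorm (fun _ => (0 : ℝ)) ^ 2 +
      3 * kahlerIntegral f (fun _ => (0 : ℝ)) = 0 := by
    rw [h0, gradNorm_const, kahlerIntegral_const_right]; norm_num
  obtain ⟨a, b, m, h1, h2⟩ := (deficit_eq_zero_iff hf contMDiff_const).1 hd
  have h3 := eq_zero_of_affine_const fun x => (h2 x).symm
  have h4 : m = 0 := by
    rw [← norm_eq_zero, ← norm_quatI, ← norm_neg, h3, norm_zero]
  exact ⟨a, fun x => by rw [h1, h4, inner_zero_left, add_zero]⟩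

theorem sum_mul_coordS3 (μ : Fin 4 → ℝ) (x : S3) :
    ∑ i, μ i * coordS3 i x = inner ℝ (WithLp.toLp 2 μ : R4) (x : R4) := by
  rw [inner_R4, Fin.sum_univ_four]; rfl

theorem isRotated_neg_quatI (m : R4) : IsRotated (fun i => m i) (fun i => (-quatI m) i) := by
  simp [IsRotated, quatI_apply]

theorem toLp_eq_neg_quatI_of_isRotated {μ σ : Fin 4 → ℝ} (h : IsRotated μ σ) :
    (WithLp.toLp 2 σ : R4) = -quatI (WithLp.toLp 2 μ) := by
  obtain ⟨h1, h2, h3, h4⟩ := h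
  ext i; fin_cases i <;> simp [quatI_apply, h1, h2, h3, h4]

theorem neg_kahlerIntegral_le {f h : S3 → ℝ} (hf : SmoothS3 f) (hh : SmoothS3 h) :
    -kahlerIntegral f h ≤ 2 / 3 * gradNorm f * gradNorm h := by
  rcases (gradNorm_nonneg f).eq_or_lt with hA | hA
  · obtain ⟨a, ha⟩ := eq_const_of_gradNorm_eq_zero hf hA.symm
    obtain rfl : f = fun _ => a := funext ha
    rw [kahlerIntegral_const_left, gradNorm_const]; simp
  rcases (gradNorm_nonneg h).eq_or_lt with hB | hB
  · obtain ⟨b, hb⟩ := eq_const_of_gradNorm_eq_zero hh hB.symm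
    obtain rfl : h = fun _ => b := funext hb
    rw [kahlerIntegral_const_right, gradNorm_const]; simp
  -- Rescaling `h` to the gradient norm of `f` makes the arithmetic-geometric mean step an equality,
  -- so nothing is lost from the deficit bound.
  have hg := gradS3_const_mul hh (gradNorm f / gradNorm h)
  have hs : SmoothS3 fun x => gradNorm f / gradNorm h * h x := contMDiff_const.mul hh
  have hd := deficit_nonneg hf hs
  rw [gradNorm_of_gradS3_eq (by positivity) hg,
    kahlerIntegral_of_gradS3_eq (fun _ => rfl) hg, div_mul_cancel₀ _ hB.ne'] at hd
  have e : gradNorm f ^ 2 + gradNorm f ^ 2 + 3 * (gradNorm f / gradNorm h * kahlerIntegral f h) =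
    gradNorm f / gradNorm h * (2 * gradNorm f * gradNorm h + 3 * kahlerIntegral f h) := by
    field_simp; ring
  rw [e] at hd
  have := nonneg_of_mul_nonneg_right hd (by positivity)
  linarith

theorem neg_kahlerIntegral_eq_of_linear (a b : ℝ) {c : ℝ} (hc : 0 < c) (m : R4) :
    -kahlerIntegral (fun x : S3 => a + inner ℝ m (x : R4))
      (fun x : S3 => b + inner ℝ (c • (-quatI m)) (x : R4)) =
      2 / 3 * gradNorm (fun x : S3 => a + inner ℝ m (x : R4)) *
        gradNorm (fun x : S3 => b + inner ℝ (c • (-quatI m)) (x : R4)) := by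
  have e1 := gradS3_affine_eq a 1 m
  have e2 := gradS3_affine_eq b c (-quatI m)
  have e1' : ∀ x, gradS3 (fun x : S3 => a + inner ℝ m (x : R4)) x =
      gradS3 (fun x : S3 => 0 + inner ℝ m (x : R4)) x := by simpa using e1
  have e1'' : ∀ x, gradS3 (fun x : S3 => a + inner ℝ m (x : R4)) x =
      (1 : ℝ) • gradS3 (fun x : S3 => 0 + inner ℝ m (x : R4)) x := by simpa using e1
  rw [kahlerIntegral_of_gradS3_eq e1' e2, gradNorm_of_gradS3_eq hc.le e2,
    gradNorm_of_gradS3_eq zero_le_one e1'', one_mul]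
  have hd := deficit_linear m
  have hle := neg_kahlerIntegral_le (smoothS3_affine 0 m) (smoothS3_affine 0 (-quatI m))
  set A := gradNorm fun x : S3 => 0 + inner ℝ m (x : R4)
  set B := gradNorm fun x : S3 => 0 + inner ℝ (-quatI m) (x : R4)
  -- Zero deficit together with the product bound gives `A² + B² ≤ 2AB`, so the two norms agree
  -- without being computed.
  have hAB : (A - B) ^ 2 = 0 := le_antisymm (by nlinarith) (sq_nonneg _)
  have : A = B := by rw [sq_eq_zero_iff] at hAB; linarith
  rw [← this] at hd ⊢
  linear_combination (-c / 3) * hd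

theorem volS3_real_univ_ne_zero : volS3.real Set.univ ≠ 0 := by
  have : Nonempty S3 := ⟨radialProj 0⟩
  rw [measureReal_def, ENNReal.toReal_ne_zero]
  exact ⟨isOpen_univ.measure_ne_zero volS3 Set.univ_nonempty, measure_ne_top _ _⟩

theorem eq_zero_of_integral_affine {a : ℝ} {m : R4}
    (h : ∫ x : S3, (a + inner ℝ m (x : R4)) ∂volS3 = 0) : a = 0 := by
  rw [integral_add (integrable_const a) (smoothOffZero_inner m).integrable, integral_linear,
    add_zero, integral_const, smul_eq_mul] at h
  exact (mul_eq_zero.1 h).resolve_left volS3_real_univ_ne_zero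

theorem corollary1p1 (f h : S3 → ℝ) (hf : SmoothS3 f) (hh : SmoothS3 h) :
    -- the Cauchy-Riemann inequality
    -kahlerIntegral f h ≤ 2 / 3 * gradNorm f * gradNorm h ∧
    -- all cases of equality
    (-kahlerIntegral f h = 2 / 3 * gradNorm f * gradNorm h ↔
      (∃ a : ℝ, ∀ x, f x = a) ∨ (∃ b : ℝ, ∀ x, h x = b) ∨
      ∃ a b c : ℝ, 0 < c ∧ ∃ f₁ ∈ eigenspaceS3 3, ∃ h₁ ∈ eigenspaceS3 3,
        (∀ x, f x = a + f₁ x) ∧ (∀ x, h x = b + c * h₁ x) ∧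
        ∃ μ σ : Fin 4 → ℝ, (∀ x, f₁ x = ∑ i, μ i * coordS3 i x) ∧
          (∀ x, h₁ x = ∑ i, σ i * coordS3 i x) ∧ IsRotated μ σ) ∧
    -- equality for normalized pairs
    (∫ x, f x ∂volS3 = 0 → ∫ x, h x ∂volS3 = 0 → gradNorm f = gradNorm h →
      (-kahlerIntegral f h = 2 / 3 * gradNorm f * gradNorm h ↔
        f ∈ eigenspaceS3 3 ∧ h ∈ eigenspaceS3 3 ∧
        ∃ μ σ : Fin 4 → ℝ, (∀ x, f x = ∑ i, μ i * coordS3 i x) ∧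
          (∀ x, h x = ∑ i, σ i * coordS3 i x) ∧ IsRotated μ σ)) := by
  refine ⟨neg_kahlerIntegral_le hf hh, ⟨fun heq => ?_, ?_⟩, fun hf0 hh0 hfh => ⟨fun heq => ?_, ?_⟩⟩
  · rcases (gradNorm_nonneg f).eq_or_lt with hA | hA
    · exact Or.inl (eq_const_of_gradNorm_eq_zero hf hA.symm)
    rcases (gradNorm_nonneg h).eq_or_lt with hB | hB
    · exact Or.inr (Or.inl (eq_const_of_gradNorm_eq_zero hh hB.symm))
    refine Or.inr (Or.inr ?_)
    -- After rescaling `h` to equal gradient norms, equality in the product bound is exactly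
    -- vanishing of the deficit.
    have hg := gradS3_const_mul hh (gradNorm f / gradNorm h)
    have hs : SmoothS3 fun x => gradNorm f / gradNorm h * h x := contMDiff_const.mul hh
    have hd : gradNorm f ^ 2 + gradNorm (fun x => gradNorm f / gradNorm h * h x) ^ 2 +
        3 * kahlerIntegral f (fun x => gradNorm f / gradNorm h * h x) = 0 := by
      rw [gradNorm_of_gradS3_eq (by positivity) hg,
        kahlerIntegral_of_gradS3_eq (fun _ => rfl) hg, div_mul_cancel₀ _ hB.ne']
      have : kahlerIntegral f h = -(2 / 3 * gradNorm f * gradNorm h) := by rw [← heq, neg_neg]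
      rw [this]
      field_simp
      ring
    obtain ⟨a, b, m, h1, h2⟩ := (deficit_eq_zero_iff hf hs).1 hd
    -- The factor `c` undoes the rescaling of `h`.
    refine ⟨a, gradNorm h / gradNorm f * b, gradNorm h / gradNorm f, by positivity, _,
      linear_mem_eigenspaceS3 m, _, linear_mem_eigenspaceS3 (-quatI m), h1, fun x => ?_,
      fun i => m i, fun i => (-quatI m) i, fun x => (sum_mul_coordS3 _ x).symm,
      fun x => (sum_mul_coordS3 _ x).symm, isRotated_neg_quatI m⟩
    rw [← mul_add, ← h2]
    field_simp
  · rintro (⟨a, ha⟩ | ⟨b, hb⟩ | ⟨a, b, c, hc, f₁, -, h₁, -, hfa, hhb, μ, σ, hμ, hσ, hr⟩)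
    · obtain rfl : f = fun _ => a := funext ha
      rw [kahlerIntegral_const_left, gradNorm_const]; simp
    · obtain rfl : h = fun _ => b := funext hb
      rw [kahlerIntegral_const_right, gradNorm_const]; simp
    · obtain rfl : f = fun x : S3 => a + inner ℝ (WithLp.toLp 2 μ : R4) (x : R4) := by
        ext x; rw [hfa, hμ, sum_mul_coordS3]
      obtain rfl : h = fun x : S3 => b +
          inner ℝ (c • (-quatI (WithLp.toLp 2 μ : R4))) (x : R4) := by
        ext x
        rw [hhb, hσ, sum_mul_coordS3, toLp_eq_neg_quatI_of_isRotated hr, inner_smul_left]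
        rfl
      exact neg_kahlerIntegral_eq_of_linear a b hc _
  · have hd : gradNorm f ^ 2 + gradNorm h ^ 2 + 3 * kahlerIntegral f h = 0 := by
      rw [← hfh] at heq ⊢
      linear_combination (-3) * heq
    obtain ⟨a, b, m, h1, h2⟩ := (deficit_eq_zero_iff hf hh).1 hd
    -- The mean-zero conditions remove the additive constants, since linear functions integrate to
    -- zero.
    simp only [h1] at hf0
    simp only [h2] at hh0
    have h1' : f = fun x : S3 => inner ℝ m (x : R4) := by
      ext x; rw [h1, eq_zero_of_integral_affine hf0, zero_add]
    have h2' : h = fun x : S3 => inner ℝ (-quatI m) (x : R4) := by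
      ext x; rw [h2, eq_zero_of_integral_affine hh0, zero_add]
    rw [h1', h2']
    exact ⟨linear_mem_eigenspaceS3 m, linear_mem_eigenspaceS3 (-quatI m), fun i => m i,
      fun i => (-quatI m) i, fun x => (sum_mul_coordS3 _ x).symm,
      fun x => (sum_mul_coordS3 _ x).symm, isRotated_neg_quatI m⟩
  · rintro ⟨-, -, μ, σ, hμ, hσ, hr⟩
    have hd := (deficit_eq_zero_iff hf hh).2 ⟨0, 0, WithLp.toLp 2 μ,
      fun x => by rw [hμ, sum_mul_coordS3, zero_add],
      fun x => by rw [hσ, sum_mul_coordS3, toLp_eq_neg_quatI_of_isRotated hr, zero_add]⟩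
    rw [← hfh] at hd ⊢
    linear_combination (-1 / 3 : ℝ) * hd
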